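/- **Setting.** Let $I=[0,1]$ with Lebesgue measure, $X=\mathbb R\times I^{\mathbb N}$ with the product of the Lebesgue measures, and let $\rho:I^2\to I$ be a measure-preserving bijection, bimeasurable. Write $x\bullet s$ for concatenation of a finite sequence and a sequence. The microcosm $\mathfrak{ll}_\rho$ is the monoid of maps $X\times I\to X\times I$ generated by $(x,s,e)\mapsto(\alpha x+\lambda,s,e)$ with $\alpha\neq0$, the finite permutations of the coordinates of $s$, the map $(a,(x,y)\bullet s,e)\mapsto(a,\rho(x,y)\bullet s,e)$ and its inverse, and the exchange $\mathtt{xch}:(a,x\bullet s,e)\mapsto(a,e\bullet s,x)$. Let $\Omega$ be a monoid (of weights) and $m:\Omega\to[0,\infty]$ any map. A *graphing* $G$ of (measurable) support $S^G\subseteq X$ is a set of edges $e$, each with a measurable source $s(e)\subseteq S^G\times I$, a realiser $\phi_e\in\mathfrak{ll}_\rho$ with $\phi_e(s(e))\subseteq S^G\times I$, and a weight $\omega(e)\in\Omega$; the factor $I$ is the *dialect*. For a bijection $B$ of $X\times I$, $B(G)$ has sources $B(s(e))$, realisers $B\phi_eB^{-1}$ and the same weights. Two graphings $F,G$ act jointly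 on $X\times I\times I$, each edge of $F$ (of $G$) fixing the second (the first) dialect, and $I\times I$ is identified with $I$ along $\rho$. An *alternating path* is a non-empty sequence of edges $\pi=e_1\dots e_k$, taken alternately in $F$ and $G$, whose maximal domain is not negligible; its realiser is $\phi_\pi=\phi_{e_k}\circ\dots\circ\phi_{e_1}$, its weight $\omega(\pi)=\omega(e_k)\cdots\omega(e_1)$. The *execution* of $F$ and $G$ is the graphing of support $S^F\mathbin\Delta S^G$ whose edges are the alternating paths, restricted to the points $p$ of their domain such that $p$ and $\phi_\pi(p)$ lie outside the cut $S^F\cap S^G$. The *measurement* $[\![F,G]\!]_m\in[0,\infty]$ is the sum, over all alternating cycles that are not proper powers, up to cyclic permutation, of $\int_{\mathrm{supp}(\pi)}m(\omega(\pi)^{n(x)})/n(x)\,dx$, where $\mathrm{supp}(\pi)$ is the set of points with a finite $\phi_\pi$-orbit contained in the domain of $\pi$ and $n(x)$ is the length of the orbit of $x$; the integral is averaged over the cyclic permutations of $\pi$. A *project* $\mathfrak a=(a,\sum_i\alpha_iA_i)$ is a wager $a\in[0,\infty]$ with a finite formal sum of graphings of equal support, $\alpha_i\in\mathbb R$. Put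 $1_A=\sum_i\alpha_i$, extend $[\![\cdot,\cdot]\!]_m$ and execution bilinearly to sums, and let $\langle\mathfrak a,\mathfrak b\rangle=a1_B+b1_A+[\![A,B]\!]_m$; the execution $\mathfrak a\odot\mathfrak b$ has wager $\langle\mathfrak a,\mathfrak b\rangle$ and the execution of $A$ and $B$ as its sum. Projects of equal supports are orthogonal when $\langle\mathfrak a,\mathfrak b\rangle$ is neither $0$ nor infinite. A *conduct* of support $V$ is a set of projects of support $V$ equal to its bi-orthogonal (taken among projects of support $V$). For conducts of disjoint supports $V,W$, $\mathbf A\multimap\mathbf B$ is the set of projects $\mathfrak f$ of support $V\cup W$ with $\mathfrak f\odot\mathfrak a\in\mathbf B$ for all $\mathfrak a\in\mathbf A$. A project is *balanced* if it is $(0,A)$ with $A$ a single graphing of coefficient $1$; it is *winning* if moreover every edge of $A$ has a reverse edge (another edge, whose source is the target of the first and whose realiser is the inverse of its realiser) and the sources of the edges are pairwise disjoint. For a balanced $\mathfrak a=(0,A)$ of support $V$, $!\mathfrak a=(0,!A)$ has support $V^!=\{(a,(d,u)\bullet s):(a,s)\in V\}$, and $!A$ acts on $(a,(d,u)\bullet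 s,e)$ as $A$ acts on $(a,s,d)$, fixing $u$ and $e$. For a conduct $\mathbf A$ of support $V$, $!\mathbf A$, of support $V^!$, is the bi-orthogonal of $\{!\mathfrak a:\mathfrak a\in\mathbf A\text{ balanced}\}$. A *delocation* is a measure-preserving automorphism $\theta$ of $X$ with $\theta\times\mathrm{Id}\in\mathfrak{ll}_\rho$ (for example a translation of $\mathbb R$); $\theta(\mathfrak a)$ is the image of $\mathfrak a$ under $\theta\times\mathrm{Id}$. **Theorem (digging).** Let $\mathbf A$ be a conduct of support $V$ and $\theta$ a delocation such that $V^!$ and $\theta(V^{!!})$ are disjoint. Let $$\mathrm{push}:(a,(x,\rho(y,\rho(z,w)))\bullet s,e)\mapsto(a,(e,z,x,y)\bullet s,w).$$ There is a winning project $\mathfrak{dig}_{\mathbf A}\in\ !\mathbf A\multimap\theta(!!\mathbf A)$ such that for every balanced project $\mathfrak a=(0,A)$ of support $V$ (in particular for all $!\mathfrak a\in{!\mathbf A}$) $$\mathfrak{dig}_{\mathbf A}\odot{!\mathfrak a}=\theta\bigl(0,\mathrm{push}(!A)\bigr)\quad\text{and}\quad(0,\mathrm{push}(!A))={!!\mathfrak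 a},$$ where the first equality is up to renaming of edges and up to edges with negligible source. -/

import Mathlib

open MeasureTheory Set
open scoped ENNReal

namespace IG

/-! ## The space, the dialect, and the microcosm -/

/-- The unit interval `[0,1]` with Lebesgue measure; it is also the dialect of every graphing. -/
abbrev I : Type := unitInterval

/-- The space `ℝ × [0,1]^ℕ`. -/
abbrev X : Type := ℝ × (ℕ → I)

/-- Product of the Lebesgue measure on `ℝ` and the product measure on the Hilbert cube. -/
noncomputable def muX : Measure X :=
  (volume : Measure ℝ).prod (Measure.infinitePi fun _ : ℕ => (volume : Measure I))

/-- The product measure on `X × [0,1]`. -/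
noncomputable def mu : Measure (X × I) := muX.prod (volume : Measure I)

/-- Concatenation `x • s`. -/
def cons (x : I) (s : ℕ → I) : ℕ → I
  | 0 => x
  | n + 1 => s n

/-- The sequence `s` without its first element. -/
def tail (s : ℕ → I) : ℕ → I := fun n => s (n + 1)

theorem cons_tail (s : ℕ → I) : cons (s 0) (tail s) = s := by
  funext n; cases n <;> rfl

theorem tail_cons (x : I) (s : ℕ → I) : tail (cons x s) = s := rfl

/-- The affine map `(x, s, e) ↦ (αx + r, s, e)`. -/
def affineMap (α r : ℝ) : X × I → X × I := fun p => ((α * p.1.1 + r, p.1.2), p.2)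

/-- The permutation of coordinates `(x, s, e) ↦ (x, s ∘ σ, e)`. -/
def permMap (σ : Equiv.Perm ℕ) : X × I → X × I := fun p => ((p.1.1, p.1.2 ∘ σ), p.2)

/-- `(a, (x, y) • s, e) ↦ (a, ρ(x, y) • s, e)`. -/
def mergeMap (ρ : (I × I) ≃ᵐ I) : X × I → X × I := fun p =>
  ((p.1.1, cons (ρ (p.1.2 0, p.1.2 1)) (tail (tail p.1.2))), p.2)

/-- The inverse of `mergeMap ρ`. -/
def splitMap (ρ : (I × I) ≃ᵐ I) : X × I → X × I := fun p =>
  ((p.1.1, cons (ρ.symm (p.1.2 0)).1 (cons (ρ.symm (p.1.2 0)).2 (tail p.1.2))), p.2)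

/-- The exchange `(a, x • s, e) ↦ (a, e • s, x)`. -/
def xch : X × I → X × I := fun p => ((p.1.1, cons p.2 (tail p.1.2)), p.1.2 0)

/-- The microcosm: the monoid of maps `X × [0,1] → X × [0,1]`, under composition, generated by the
(invertible) affine maps, the finite permutations, the merging map and its inverse, and the
exchange. -/
def microcosm (ρ : (I × I) ≃ᵐ I) : Submonoid (Function.End (X × I)) :=
  Submonoid.closure
    ({f | ∃ α r : ℝ, α ≠ 0 ∧ f = affineMap α r} ∪
     {f | ∃ σ : Equiv.Perm ℕ, {n | σ n ≠ n}.Finite ∧ f = permMap σ} ∪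
     {f | f = mergeMap ρ ∨ f = splitMap ρ ∨ f = xch})

/-! ## Graphings -/

/-- The data of a thick graphing with weights in `Ω` and dialect `[0,1]`. -/
structure Graphing (Ω : Type*) where
  support : Set X
  Edge : Type
  source : Edge → Set (X × I)
  realiser : Edge → X × I → X × I
  weight : Edge → Ω

namespace Graphing

variable {Ω : Type*}

/-- The conditions that make the data a graphing over the microcosm of `ρ`. -/
structure IsGraphing (ρ : (I × I) ≃ᵐ I) (G : Graphing Ω) : Prop where
  measurableSet_support : MeasurableSet G.support
  measurableSet_source : ∀ e, MeasurableSet (G.source e)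
  source_subset : ∀ e, G.source e ⊆ G.support ×ˢ univ
  realiser_mem : ∀ e, (G.realiser e : Function.End (X × I)) ∈ microcosm ρ
  target_subset : ∀ e, G.realiser e '' G.source e ⊆ G.support ×ˢ univ

/-- The target of an edge. -/
def target (G : Graphing Ω) (e : G.Edge) : Set (X × I) := G.realiser e '' G.source e

/-- The image `B(G)` of a graphing under a bijection `B` of `X × [0,1]`. -/
def conj (B : (X × I) ≃ (X × I)) (G : Graphing Ω) : Graphing Ω where
  support := Prod.fst '' (B '' (G.support ×ˢ univ))
  Edge := G.Edge
  source e := B '' G.source e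
  realiser e := B ∘ G.realiser e ∘ B.symm
  weight := G.weight

/-- `G × Id`: the dialect of `G` is extended to `D × [0,1]`, identified with `[0,1]` along `ρ`. -/
def extRight (ρ : (I × I) ≃ᵐ I) (G : Graphing Ω) : Graphing Ω where
  support := G.support
  Edge := G.Edge
  source e := {p | (p.1, (ρ.symm p.2).1) ∈ G.source e}
  realiser e p :=
    let q := G.realiser e (p.1, (ρ.symm p.2).1)
    (q.1, ρ (q.2, (ρ.symm p.2).2))
  weight := G.weight

/-- `Id × G`: the dialect of `G` is extended to `[0,1] × D`, identified with `[0,1]` along `ρ`. -/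
def extLeft (ρ : (I × I) ≃ᵐ I) (G : Graphing Ω) : Graphing Ω where
  support := G.support
  Edge := G.Edge
  source e := {p | (p.1, (ρ.symm p.2).2) ∈ G.source e}
  realiser e p :=
    let q := G.realiser e (p.1, (ρ.symm p.2).2)
    (q.1, ρ ((ρ.symm p.2).1, q.2))
  weight := G.weight

/-- All edges of `F` and of `G`, acting on `X × (D^F × D^G)`; edges of `F` do not change the
dialect of `G` and conversely. -/
def join (ρ : (I × I) ≃ᵐ I) (F G : Graphing Ω) : Graphing Ω where
  support := F.support ∪ G.support
  Edge := F.Edge ⊕ G.Edge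
  source := Sum.elim (F.extRight ρ).source (G.extLeft ρ).source
  realiser := Sum.elim (F.extRight ρ).realiser (G.extLeft ρ).realiser
  weight := Sum.elim F.weight G.weight

/-! ### Paths -/

/-- The maximal domain of a sequence of edges. -/
def pathSource (G : Graphing Ω) : List G.Edge → Set (X × I)
  | [] => univ
  | e :: l => G.source e ∩ G.realiser e ⁻¹' pathSource G l

/-- The composite of the realisers along a sequence of edges. -/
def pathRealiser (G : Graphing Ω) : List G.Edge → X × I → X × I
  | [] => id
  | e :: l => pathRealiser G l ∘ G.realiser e

/-- The weight `ω(e_k) ⋯ ω(e_1)` of a sequence of edges. -/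
def pathWeight [Monoid Ω] (G : Graphing Ω) : List G.Edge → Ω
  | [] => 1
  | e :: l => pathWeight G l * G.weight e

/-- Alternation: two consecutive edges do not come from the same graphing. -/
def Alternates {E E' : Type} (a b : E ⊕ E') : Prop := a.isLeft ≠ b.isLeft

/-- Alternating paths between `F` and `G`: non-empty alternating sequences of edges that are
composable on a set of positive measure. -/
def IsAltPath (ρ : (I × I) ≃ᵐ I) (F G : Graphing Ω) (l : List (F.Edge ⊕ G.Edge)) : Prop :=
  l ≠ [] ∧ l.IsChain Alternates ∧ mu ((join ρ F G).pathSource l) ≠ 0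

/-- Execution: the edges are the alternating paths, restricted to the points outside the cut
(the intersection of the supports) whose image lies outside the cut. -/
def exec [Monoid Ω] (ρ : (I × I) ≃ᵐ I) (F G : Graphing Ω) : Graphing Ω where
  support := symmDiff F.support G.support
  Edge := {l : List (F.Edge ⊕ G.Edge) // IsAltPath ρ F G l}
  source l := (join ρ F G).pathSource l.1 ∩
    {p | p.1 ∉ F.support ∩ G.support ∧
      ((join ρ F G).pathRealiser l.1 p).1 ∉ F.support ∩ G.support}
  realiser l := (join ρ F G).pathRealiser l.1
  weight l := (join ρ F G).pathWeight l.1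

/-! ### Measurement -/

/-- Alternating 1-cycles between two graphings: cyclically alternating sequences of edges that are
not a proper power of a shorter sequence. (Cycles of negligible domain contribute nothing to the
measurement.) -/
def IsAltCycle {E E' : Type} (l : List (E ⊕ E')) : Prop :=
  l ≠ [] ∧ (l ++ l).IsChain Alternates ∧
    ∀ (c : List (E ⊕ E')) (n : ℕ), l = (List.replicate n c).flatten → n = 1

/-- The support of a cycle: the points with a finite orbit that stays in the domain of the cycle. -/
def cycleSupport (G : Graphing Ω) (l : List G.Edge) : Set (X × I) :=
  {p | p ∈ Function.periodicPts (G.pathRealiser l) ∧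
    ∀ k : ℕ, (G.pathRealiser l)^[k] p ∈ G.pathSource l}

/-- The integral, over the support of a cycle of weight `ω`, of `m (ω ^ n(x)) / n(x)`, where `n(x)`
is the length of the orbit of `x`. -/
noncomputable def cycleMeas [Monoid Ω] (m : Ω → ℝ≥0∞) (G : Graphing Ω) (l : List G.Edge) : ℝ≥0∞ :=
  ∫⁻ x in G.cycleSupport l,
    m (G.pathWeight l ^ Function.minimalPeriod (G.pathRealiser l) x) /
      (Function.minimalPeriod (G.pathRealiser l) x : ℝ≥0∞) ∂mu

/-- The measurement of a pair of graphings: the sum over all circuits (1-cycles up to cyclic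
permutation) of the integral above. A circuit of length `k` has exactly `k` representatives; its
value is the mean over these, which is the common value when it does not depend on the
representative (as for measure-preserving realisers and `m` with `m (u * v) = m (v * u)`). -/
noncomputable def meas [Monoid Ω] (ρ : (I × I) ≃ᵐ I) (m : Ω → ℝ≥0∞) (F G : Graphing Ω) : ℝ≥0∞ :=
  ∑' l : {l : List (F.Edge ⊕ G.Edge) // IsAltCycle l},
    cycleMeas m (join ρ F G) l.1 / (l.1.length : ℝ≥0∞)

/-- Equality of graphings up to renaming of edges and up to edges of negligible source. -/
def Equivalent (F G : Graphing Ω) : Prop :=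
  F.support = G.support ∧
  ∃ f : {e : F.Edge // mu (F.source e) ≠ 0} ≃ {e : G.Edge // mu (G.source e) ≠ 0},
    ∀ e, G.source (f e).1 = F.source e.1 ∧ G.realiser (f e).1 = F.realiser e.1 ∧
      G.weight (f e).1 = F.weight e.1

/-- Disjoint unions of transpositions: every edge has a reverse edge, and the sources of the edges
are pairwise disjoint. -/
def IsUnionOfTranspositions (G : Graphing Ω) : Prop :=
  (∀ e, ∃ e', e' ≠ e ∧ G.source e' = G.target e ∧
    Function.LeftInverse (G.realiser e') (G.realiser e) ∧
    Function.RightInverse (G.realiser e') (G.realiser e)) ∧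
  ∀ e e', e ≠ e' → Disjoint (G.source e) (G.source e')

end Graphing

/-! ### Perennisation -/

/-- The bijection `B : (a, s, d) ↦ (a, d • s)`. -/
def hide : (X × I) ≃ X where
  toFun p := (p.1.1, cons p.2 p.1.2)
  invFun y := ((y.1, tail y.2), y.2 0)
  left_inv p := by simp [tail_cons, cons]
  right_inv y := by simp [cons_tail]

/-- The set of all `(a, (d, u) • s)` with `(a, s) ∈ V`. -/
def bangSupport (V : Set X) : Set X := {y | (hide.symm (hide.symm y).1).1 ∈ V}

/-- Perennisation of graphings: a point `(a, (d, u) • s)` of the new support stands for the point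
`(a, s)` and the state `d` of the given graphing together with an unused parameter `u`; the new
dialect is not used. -/
def Graphing.bang {Ω : Type*} (G : Graphing Ω) : Graphing Ω where
  support := bangSupport G.support
  Edge := G.Edge
  source e := {p | ((hide.symm (hide.symm p.1).1).1, (hide.symm p.1).2) ∈ G.source e}
  realiser e p :=
    let d := (hide.symm p.1).2
    let y := hide.symm (hide.symm p.1).1
    let q := G.realiser e (y.1, d)
    (hide (hide (q.1, y.2), q.2), p.2)
  weight := G.weight

/-- `push : (a, (x, ρ(y, ρ(z, w))) • s, e) ↦ (a, (e, z, x, y) • s, w)`. -/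
def push (ρ : (I × I) ≃ᵐ I) : (X × I) ≃ (X × I) where
  toFun p :=
    let x := p.1.2 0
    let yr := ρ.symm (p.1.2 1)
    let zw := ρ.symm yr.2
    ((p.1.1, cons p.2 (cons zw.1 (cons x (cons yr.1 (tail (tail p.1.2)))))), zw.2)
  invFun p :=
    ((p.1.1, cons (p.1.2 2) (cons (ρ (p.1.2 3, ρ (p.1.2 1, p.2)))
      (tail (tail (tail (tail p.1.2)))))), p.1.2 0)
  left_inv p := by
    obtain ⟨⟨a, s⟩, e⟩ := p
    refine Prod.ext (Prod.ext rfl ?_) rfl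
    funext n
    rcases n with _ | _ | n <;> simp [cons, tail]
  right_inv p := by
    obtain ⟨⟨a, s⟩, e⟩ := p
    refine Prod.ext (Prod.ext rfl ?_) (by simp [cons])
    funext n
    rcases n with _ | _ | _ | _ | n <;> simp [cons, tail]

/-! ## Projects -/

/-- The data of a project: a wager and a finite formal weighted sum of graphings. -/
structure Project (Ω : Type*) where
  support : Set X
  wager : EReal
  Index : Type
  [fintypeIndex : Fintype Index]
  coeff : Index → ℝ
  slice : Index → Graphing Ω

attribute [instance] Project.fintypeIndex

namespace Project

variable {Ω : Type*}

/-- The wager lies in `[0, ∞]` and the slices are graphings with the support of the project. -/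
structure IsProject (ρ : (I × I) ≃ᵐ I) (a : Project Ω) : Prop where
  measurableSet_support : MeasurableSet a.support
  wager_nonneg : 0 ≤ a.wager
  support_slice : ∀ i, (a.slice i).support = a.support
  isGraphing_slice : ∀ i, (a.slice i).IsGraphing ρ

/-- The sum of the coefficients. -/
def unit (a : Project Ω) : ℝ := ∑ i, a.coeff i

/-- `a 1_B + b 1_A + ⟦A, B⟧`, the measurement being extended bilinearly to formal sums. -/
noncomputable def pairing [Monoid Ω] (ρ : (I × I) ≃ᵐ I) (m : Ω → ℝ≥0∞) (a b : Project Ω) : EReal :=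
  a.wager * (b.unit : EReal) + b.wager * (a.unit : EReal) +
    ∑ i, ∑ j, ((a.coeff i * b.coeff j : ℝ) : EReal) *
      ((Graphing.meas ρ m (a.slice i) (b.slice j) : ℝ≥0∞) : EReal)

/-- Execution of projects. -/
noncomputable def exec [Monoid Ω] (ρ : (I × I) ≃ᵐ I) (m : Ω → ℝ≥0∞) (a b : Project Ω) :
    Project Ω where
  support := symmDiff a.support b.support
  wager := pairing ρ m a b
  Index := a.Index × b.Index
  coeff ij := a.coeff ij.1 * b.coeff ij.2
  slice ij := (a.slice ij.1).exec ρ (b.slice ij.2)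

/-- The image of a project under a bijection of `X × [0,1]`. -/
def conj (B : (X × I) ≃ (X × I)) (a : Project Ω) : Project Ω where
  support := Prod.fst '' (B '' (a.support ×ˢ univ))
  wager := a.wager
  Index := a.Index
  coeff := a.coeff
  slice i := (a.slice i).conj B

/-- Balanced projects: wager zero and one slice, with coefficient one. -/
def IsBalanced (a : Project Ω) : Prop :=
  a.wager = 0 ∧ ∃ i : a.Index, (∀ j, j = i) ∧ a.coeff i = 1

/-- Perennisation of projects (meant for balanced ones). -/
def bang (a : Project Ω) : Project Ω where
  support := bangSupport a.support
  wager := a.wager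
  Index := a.Index
  coeff := a.coeff
  slice i := (a.slice i).bang

/-- Winning projects. -/
def IsWinning (a : Project Ω) : Prop :=
  a.IsBalanced ∧ ∀ i, (a.slice i).IsUnionOfTranspositions

/-- Equality of projects up to renaming of slices and edges and up to negligible edges. -/
def Equivalent (a b : Project Ω) : Prop :=
  a.support = b.support ∧ a.wager = b.wager ∧
  ∃ f : a.Index ≃ b.Index, ∀ i, b.coeff (f i) = a.coeff i ∧
    (a.slice i).Equivalent (b.slice (f i))

/-- Orthogonality: the pairing is neither zero nor infinite. -/
def Orthogonal [Monoid Ω] (ρ : (I × I) ≃ᵐ I) (m : Ω → ℝ≥0∞) (a b : Project Ω) : Prop :=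
  a.support = b.support ∧ pairing ρ m a b ≠ 0 ∧ pairing ρ m a b ≠ ⊤ ∧ pairing ρ m a b ≠ ⊥

end Project

/-! ## Conducts -/

section Conducts

variable {Ω : Type*} [Monoid Ω]

/-- The orthogonal of a set `T` of projects of support `V`. -/
def orth (ρ : (I × I) ≃ᵐ I) (m : Ω → ℝ≥0∞) (V : Set X) (T : Set (Project Ω)) : Set (Project Ω) :=
  {a | a.IsProject ρ ∧ a.support = V ∧ ∀ b ∈ T, a.Orthogonal ρ m b}

/-- Conducts of support `V`: bi-orthogonally closed sets of projects of support `V`. -/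
def IsConduct (ρ : (I × I) ≃ᵐ I) (m : Ω → ℝ≥0∞) (V : Set X) (A : Set (Project Ω)) : Prop :=
  MeasurableSet V ∧ A = orth ρ m V (orth ρ m V A)

/-- `♯A`: the perennisations of the balanced elements of `A`. -/
def sharp (A : Set (Project Ω)) : Set (Project Ω) :=
  {b | ∃ a ∈ A, a.IsBalanced ∧ b = a.bang}

/-- The perennial conduct `!A` of a conduct `A` of support `V`; its support is `bangSupport V`. -/
def ofCourse (ρ : (I × I) ≃ᵐ I) (m : Ω → ℝ≥0∞) (V : Set X) (A : Set (Project Ω)) :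
    Set (Project Ω) :=
  orth ρ m (bangSupport V) (orth ρ m (bangSupport V) (sharp A))

/-- Linear implication `A ⊸ B` between conducts of disjoint supports `V` and `W`. -/
def lolly (ρ : (I × I) ≃ᵐ I) (m : Ω → ℝ≥0∞) (V W : Set X) (A B : Set (Project Ω)) :
    Set (Project Ω) :=
  {f | f.IsProject ρ ∧ f.support = V ∪ W ∧ ∀ a ∈ A, f.exec ρ m a ∈ B}

end Conducts

/-! ## Delocations -/

/-- A delocation: a measure-preserving bijection of `X` that belongs to the microcosm. It moves
projects and conducts to another location in `X`. -/
def IsDelocation (ρ : (I × I) ≃ᵐ I) (θ : X ≃ᵐ X) : Prop :=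
  MeasurePreserving θ muX muX ∧
    ((fun p => (θ p.1, p.2) : X × I → X × I) : Function.End (X × I)) ∈ microcosm ρ

/-- The project `a` moved along `θ`. -/
def Project.deloc {Ω : Type*} (θ : X ≃ᵐ X) (a : Project Ω) : Project Ω :=
  a.conj (θ.toEquiv.prodCongr (Equiv.refl I))

end IG

open IG

/-! Digging is a wire. With `W = V^!`, `U = θ(V^!!)` and `K = θ ∘ push`, the witness has two
mutually reverse edges of weight 1: `K` from `W` to `U`, and its inverse. `push` is a product of
exchanges, splittings and coordinate swaps, so `K` lies in the microcosm and preserves the measure.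
It carries `W × I` onto `U × I` because both supports only test the base point and the tail `s`,
which `push` leaves alone.

Let `B` be a graphing of support `W`. After an edge of `B` one is over `W`; one wire edge then leads
to `U`, where no edge of `B` starts. Hence alternating paths have at most three edges, no cycle
contributes to the measurement, and the only paths from outside the cut `W` to outside it are `K e
K⁻¹` with `e` an edge of `B` (`along_equivalent_exec`). The dialect of the wire is carried along,
which is recorded by `along`. If `B = !A`, no realiser uses the dialect, so `along` is plain
conjugation. As `push` only rearranges the unused parameter and the dialect, conjugating `!A` by it
gives exactly `!!A` (`push_bangMap`, `along_digEquiv_bang`).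

For a general element `b` of the bi-orthogonal no such formula is available, and membership is
proved by adjunction. A measure-preserving change of coordinates that regroups the dialects gives
`⟦F, along K⁻¹ G⟧ = ⟦along K F, G⟧` (`meas_along`, from `meas_transfer`). So pairing `θ⁻¹(dig ⊙ b)`
with a test `t` equals pairing `b` with a transported test `undig t` (`pairing_deloc_exec`). On
generators the same adjunction gives `⟨undig t, !a⟩ = ⟨t, !!a⟩` (`pairing_undig_bang`). If `t` is
orthogonal to `♯(!A)`, which contains every `!!a` with `a` balanced in `A`, then `undig t` is
orthogonal to `♯A`, hence to `b`. -/

namespace IG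

/-! ## Sequences -/

theorem measurable_cons : Measurable fun p : I × (ℕ → I) => cons p.1 p.2 := by
  refine measurable_pi_iff.2 fun n => ?_
  cases n with
  | zero => exact measurable_fst
  | succ n => exact (measurable_pi_apply n).comp measurable_snd

theorem measurable_tail : Measurable tail :=
  measurable_pi_iff.2 fun n => measurable_pi_apply (n + 1)

/-- Concatenation as a measurable equivalence. -/
def consEquiv : I × (ℕ → I) ≃ᵐ (ℕ → I) where
  toFun p := cons p.1 p.2
  invFun s := (s 0, tail s)
  left_inv _ := rfl
  right_inv s := cons_tail s
  measurable_toFun := measurable_cons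
  measurable_invFun := (measurable_pi_apply 0).prodMk measurable_tail

/-- The product measure on the Hilbert cube. -/
noncomputable abbrev muSeq : Measure (ℕ → I) := Measure.infinitePi fun _ : ℕ => (volume : Measure I)

instance : SFinite muX := by unfold muX; infer_instance

instance : SFinite mu := by unfold mu; infer_instance

/-- An infinite product measure is determined by its values on boxes over finitely many coordinates.
The preimage of such a box is the constraint on coordinate 0 times a shifted box, so the product of
volumes merely loses and regains the factor at 0. -/
theorem measurePreserving_consEquiv :
    MeasurePreserving consEquiv ((volume : Measure I).prod muSeq) muSeq := by
  refine ⟨consEquiv.measurable, Measure.eq_infinitePi _ fun s t ht => ?_⟩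
  rw [consEquiv.map_apply]
  -- When `0 ∉ s` the first coordinate is unconstrained and contributes the factor 1.
  have hpre : consEquiv ⁻¹' (Set.pi s t) =
      (if 0 ∈ s then t 0 else univ) ×ˢ
        Set.pi (s.preimage Nat.succ Nat.succ_injective.injOn : Finset ℕ) (fun n => t (n + 1)) := by
    ext ⟨x, u⟩
    simp only [mem_preimage, Set.mem_pi, mem_prod, Finset.coe_preimage, Finset.mem_coe]
    constructor
    · intro h
      refine ⟨?_, fun n hn => h (n + 1) hn⟩
      split_ifs with h0
      · exact h 0 h0
      · trivial
    · rintro ⟨h0, h1⟩ n hn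
      cases n with
      | zero => rw [if_pos hn] at h0; exact h0
      | succ n => exact h1 n hn
  have hprod : ∏ n ∈ s.preimage Nat.succ Nat.succ_injective.injOn, (volume : Measure I) (t (n + 1))
      = ∏ n ∈ s.erase 0, (volume : Measure I) (t n) := by
    refine Finset.prod_bij (fun n _ => n + 1) ?_ ?_ ?_ ?_
    · intro n hn; simpa using hn
    · intro a _ b _ h; exact Nat.succ_injective h
    · intro n hn
      obtain ⟨h0, h1⟩ := Finset.mem_erase.1 hn
      obtain ⟨k, rfl⟩ := Nat.exists_eq_succ_of_ne_zero h0
      exact ⟨k, by simpa using h1, rfl⟩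
    · intro n _; rfl
  rw [hpre, Measure.prod_prod, Measure.infinitePi_pi _ (fun i _ => ht _), hprod]
  split_ifs with h0
  · exact Finset.mul_prod_erase s (fun n => (volume : Measure I) (t n)) h0
  · rw [Finset.erase_eq_of_notMem h0]; simp

/-! ## The generators of the microcosm -/

/-- A bijection of `X × [0,1]` from one of the sequences. -/
def onSeq (φ : (ℕ → I) → (ℕ → I)) : X × I → X × I := Prod.map (Prod.map id φ) id

theorem measurePreserving_onSeq {φ : (ℕ → I) → (ℕ → I)} (h : MeasurePreserving φ muSeq muSeq) :
    MeasurePreserving (onSeq φ) mu mu :=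
  ((MeasurePreserving.id _).prod h).prod (MeasurePreserving.id _)

theorem measurePreserving_permMap (σ : Equiv.Perm ℕ) : MeasurePreserving (permMap σ) mu mu := by
  refine measurePreserving_onSeq (φ := fun s => s ∘ σ) ?_
  refine ⟨measurable_pi_iff.2 fun n => measurable_pi_apply _, ?_⟩
  -- Reindexing along an equivalence composes with its inverse, so `σ.symm` is what yields `s ∘ σ`.
  have h := Measure.infinitePi_map_piCongrLeft (X := fun _ : ℕ => I)
    (fun _ : ℕ => (volume : Measure I)) σ.symm
  convert h using 2
  funext s n
  simp [Equiv.piCongrLeft_apply, MeasurableEquiv.piCongrLeft]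

variable (ρ : (I × I) ≃ᵐ I)

/-- Merging of the first two coordinates of a sequence. -/
def mergeSeq : (ℕ → I) ≃ᵐ (ℕ → I) :=
  consEquiv.symm.trans <| ((MeasurableEquiv.refl I).prodCongr consEquiv.symm).trans <|
    MeasurableEquiv.prodAssoc.symm.trans <| (ρ.prodCongr (MeasurableEquiv.refl _)).trans consEquiv

variable {ρ}

theorem measurePreserving_mergeSeq (hρ : MeasurePreserving ρ) :
    MeasurePreserving (mergeSeq ρ) muSeq muSeq := by
  have h1 := measurePreserving_consEquiv.symm consEquiv
  have h2 := (MeasurePreserving.id (volume : Measure I)).prod h1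
  have h3 := measurePreserving_prodAssoc (volume : Measure I) (volume : Measure I) muSeq
  have h4 := hρ.prod (MeasurePreserving.id muSeq)
  exact measurePreserving_consEquiv.comp (h4.comp
    ((h3.symm MeasurableEquiv.prodAssoc).comp (h2.comp h1)))

theorem measurePreserving_mergeMap (hρ : MeasurePreserving ρ) :
    MeasurePreserving (mergeMap ρ) mu mu :=
  measurePreserving_onSeq (measurePreserving_mergeSeq hρ)

theorem measurePreserving_splitMap (hρ : MeasurePreserving ρ) :
    MeasurePreserving (splitMap ρ) mu mu :=
  measurePreserving_onSeq ((measurePreserving_mergeSeq hρ).symm (mergeSeq ρ))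

theorem measurePreserving_xch : MeasurePreserving xch mu mu := by
  have hc := measurePreserving_consEquiv
  have h1 := (hc.symm consEquiv).prod (MeasurePreserving.id (volume : Measure I))
  have h2 := measurePreserving_prodAssoc (volume : Measure I) muSeq (volume : Measure I)
  have h3 : MeasurePreserving Prod.swap ((volume : Measure I).prod (muSeq.prod (volume : Measure I))) _ :=
    Measure.measurePreserving_swap
  have h4 : MeasurePreserving Prod.swap (muSeq.prod (volume : Measure I)) _ :=
    Measure.measurePreserving_swap
  have h5 := (hc.comp h4).prod (MeasurePreserving.id (volume : Measure I))
  have h6 := h5.comp (h3.comp (h2.comp h1))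
  have h7 := measurePreserving_prodAssoc (volume : Measure ℝ) muSeq (volume : Measure I)
  exact (h7.symm MeasurableEquiv.prodAssoc).comp
    (((MeasurePreserving.id (volume : Measure ℝ)).prod h6).comp h7)

theorem quasiMeasurePreserving_affineMap {α : ℝ} (hα : α ≠ 0) (r : ℝ) :
    Measure.QuasiMeasurePreserving (affineMap α r) mu mu := by
  have h : Measure.QuasiMeasurePreserving (fun x : ℝ => α * x + r) volume volume :=
    (measurePreserving_add_right volume r).quasiMeasurePreserving.comp
      (Measure.quasiMeasurePreserving_smul (μ := (volume : Measure ℝ)) hα)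
  exact QuasiMeasurePreserving.prodMap (QuasiMeasurePreserving.prodMap h
    (Measure.QuasiMeasurePreserving.id muSeq)) (Measure.QuasiMeasurePreserving.id volume)

theorem mergeMap_splitMap (p : X × I) : mergeMap ρ (splitMap ρ p) = p :=
  congrArg (fun s => (((p.1.1, s), p.2) : X × I)) ((mergeSeq ρ).apply_symm_apply p.1.2)

theorem splitMap_mergeMap (p : X × I) : splitMap ρ (mergeMap ρ p) = p :=
  congrArg (fun s => (((p.1.1, s), p.2) : X × I)) ((mergeSeq ρ).symm_apply_apply p.1.2)

theorem xch_xch (p : X × I) : xch (xch p) = p := by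
  obtain ⟨⟨a, s⟩, e⟩ := p
  exact Prod.ext (Prod.ext rfl (cons_tail s)) rfl

/-! ## The microcosm -/

/-- Membership in the microcosm. -/
def Mic (ρ : (I × I) ≃ᵐ I) (φ : X × I → X × I) : Prop := (φ : Function.End (X × I)) ∈ microcosm ρ

theorem Mic.id : Mic ρ _root_.id := (microcosm ρ).one_mem

theorem Mic.comp {φ ψ : X × I → X × I} (hφ : Mic ρ φ) (hψ : Mic ρ ψ) : Mic ρ (φ ∘ ψ) :=
  (microcosm ρ).mul_mem hφ hψ

theorem mic_affineMap {α : ℝ} (hα : α ≠ 0) (r : ℝ) : Mic ρ (affineMap α r) :=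
  Submonoid.subset_closure (Or.inl (Or.inl ⟨α, r, hα, rfl⟩))

theorem mic_permMap {σ : Equiv.Perm ℕ} (hσ : {n | σ n ≠ n}.Finite) : Mic ρ (permMap σ) :=
  Submonoid.subset_closure (Or.inl (Or.inr ⟨σ, hσ, rfl⟩))

theorem mic_mergeMap : Mic ρ (mergeMap ρ) :=
  Submonoid.subset_closure (Or.inr (Or.inl rfl))

theorem mic_splitMap : Mic ρ (splitMap ρ) :=
  Submonoid.subset_closure (Or.inr (Or.inr (Or.inl rfl)))

theorem mic_xch : Mic ρ xch :=
  Submonoid.subset_closure (Or.inr (Or.inr (Or.inr rfl)))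

/-- Exchange of two coordinates of the sequence. -/
def swp (i j : ℕ) : X × I → X × I := permMap (Equiv.swap i j)

theorem mic_swp (i j : ℕ) : Mic ρ (swp i j) := by
  refine mic_permMap ((Set.toFinite {i, j}).subset fun n hn => ?_)
  by_contra h
  simp only [mem_insert_iff, mem_singleton_iff, not_or] at h
  exact hn (Equiv.swap_apply_of_ne_of_ne h.1 h.2)

/-- Induction on the generators of the microcosm. -/
theorem Mic.induction {P : (X × I → X × I) → Prop}
    (affine : ∀ α r : ℝ, α ≠ 0 → P (affineMap α r))
    (perm : ∀ σ : Equiv.Perm ℕ, {n | σ n ≠ n}.Finite → P (permMap σ))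
    (merge : P (mergeMap ρ)) (split : P (splitMap ρ)) (exch : P xch) (one : P _root_.id)
    (comp : ∀ φ ψ, P φ → P ψ → P (φ ∘ ψ)) {φ : X × I → X × I} (hφ : Mic ρ φ) : P φ := by
  refine Submonoid.closure_induction (motive := fun (f : Function.End (X × I)) _ => P f) ?_ one
    (fun f g _ _ hf hg => comp f g hf hg) hφ
  rintro f ((⟨α, r, hα, rfl⟩ | ⟨σ, hσ, rfl⟩) | (rfl | rfl | rfl))
  exacts [affine α r hα, perm σ hσ, merge, split, exch]

/-- Affine maps rescale Lebesgue measure, so the microcosm as a whole only respects null sets. This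
suffices to make path domains measurable and to discard every path through a negligible edge; exact
invariance is needed only of `push` and `θ`. -/
theorem Mic.quasiMeasurePreserving (hρ : MeasurePreserving ρ) {φ : X × I → X × I} (hφ : Mic ρ φ) :
    Measure.QuasiMeasurePreserving φ mu mu := by
  refine Mic.induction (P := fun φ => Measure.QuasiMeasurePreserving φ mu mu)
    (fun α r hα => quasiMeasurePreserving_affineMap hα r)
    (fun σ _ => (measurePreserving_permMap σ).quasiMeasurePreserving)
    (measurePreserving_mergeMap hρ).quasiMeasurePreserving
    (measurePreserving_splitMap hρ).quasiMeasurePreserving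
    measurePreserving_xch.quasiMeasurePreserving
    (Measure.QuasiMeasurePreserving.id mu) (fun φ ψ h1 h2 => h1.comp h2) hφ

theorem Mic.exists_inverse {φ : X × I → X × I} (hφ : Mic ρ φ) :
    ∃ ψ, Mic ρ ψ ∧ Function.LeftInverse ψ φ ∧ Function.RightInverse ψ φ := by
  refine Mic.induction
    (P := fun φ => ∃ ψ, Mic ρ ψ ∧ Function.LeftInverse ψ φ ∧ Function.RightInverse ψ φ)
    ?_ ?_ ⟨_, mic_splitMap, splitMap_mergeMap, mergeMap_splitMap⟩
    ⟨_, mic_mergeMap, mergeMap_splitMap, splitMap_mergeMap⟩ ⟨_, mic_xch, xch_xch, xch_xch⟩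
    ⟨_, Mic.id, fun _ => rfl, fun _ => rfl⟩ ?_ hφ
  · intro α r hα
    refine ⟨affineMap α⁻¹ (-(α⁻¹ * r)), mic_affineMap (inv_ne_zero hα) _, fun p => ?_, fun p => ?_⟩
    · refine Prod.ext (Prod.ext ?_ rfl) rfl
      simp only [affineMap]; field_simp; ring
    · refine Prod.ext (Prod.ext ?_ rfl) rfl
      simp only [affineMap]; field_simp; ring
  · intro σ hσ
    refine ⟨permMap σ⁻¹, mic_permMap ?_, fun p => ?_, fun p => ?_⟩
    · convert hσ using 1
      ext n
      simp only [mem_ofPred_eq, ne_eq, not_iff_not]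
      rw [Equiv.Perm.inv_eq_iff_eq, eq_comm]
    · refine Prod.ext (Prod.ext rfl (funext fun n => ?_)) rfl
      simp [permMap]
    · refine Prod.ext (Prod.ext rfl (funext fun n => ?_)) rfl
      simp [permMap]
  · rintro φ ψ ⟨φ', h1, h2, h3⟩ ⟨ψ', h4, h5, h6⟩
    exact ⟨ψ' ∘ φ', h4.comp h1, h2.comp h5, Function.RightInverse.comp h3 h6⟩

theorem Mic.symm {B : (X × I) ≃ (X × I)} (h : Mic ρ B) : Mic ρ B.symm := by
  obtain ⟨ψ, h1, h2, -⟩ := h.exists_inverse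
  have : (B.symm : X × I → X × I) = ψ := by
    funext p
    conv_rhs => rw [← B.apply_symm_apply p]
    exact (h2 _).symm
  rwa [this]

/-! ### Extension of the dialect within the microcosm -/

/-- The extension of a map of `X × [0,1]` by an unused second dialect. -/
def extR (ρ : (I × I) ≃ᵐ I) (φ : X × I → X × I) (p : X × I) : X × I :=
  ((φ (p.1, (ρ.symm p.2).1)).1, ρ ((φ (p.1, (ρ.symm p.2).1)).2, (ρ.symm p.2).2))

/-- The extension of a map of `X × [0,1]` by an unused first dialect. -/
def extL (ρ : (I × I) ≃ᵐ I) (φ : X × I → X × I) (p : X × I) : X × I :=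
  ((φ (p.1, (ρ.symm p.2).2)).1, ρ ((ρ.symm p.2).1, (φ (p.1, (ρ.symm p.2).2)).2))

theorem extR_id : extR ρ id = id := by funext p; simp [extR]

theorem extL_id : extL ρ id = id := by funext p; simp [extL]

theorem extR_comp (φ ψ : X × I → X × I) : extR ρ (φ ∘ ψ) = extR ρ φ ∘ extR ρ ψ := by
  funext p; simp [extR]

theorem extL_comp (φ ψ : X × I → X × I) : extL ρ (φ ∘ ψ) = extL ρ φ ∘ extL ρ ψ := by
  funext p; simp [extL]

/-- The paired dialect is exchanged into the sequence and split there; its first half is exchanged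
with the waiting coordinate, and the new pair is merged and sent back. -/
theorem extR_xch : extR ρ xch = xch ∘ mergeMap ρ ∘ xch ∘ splitMap ρ ∘ xch := by
  funext p
  refine Prod.ext (Prod.ext rfl (funext fun n => ?_)) ?_
  · rcases n with _ | n <;> simp [extR, xch, mergeMap, splitMap, cons, tail]
  · simp [extR, xch, mergeMap, splitMap, cons, tail]

/-- As for `extR_xch`, with swaps that bring the second half of the pair to the front before the
inner exchange and put it back afterwards. -/
theorem extL_xch : extL ρ xch =
    xch ∘ mergeMap ρ ∘ swp 0 1 ∘ xch ∘ swp 0 1 ∘ splitMap ρ ∘ xch := by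
  funext p
  refine Prod.ext (Prod.ext rfl (funext fun n => ?_)) ?_
  · rcases n with _ | n <;>
      simp [extL, xch, mergeMap, splitMap, cons, tail, swp, permMap, Equiv.swap_apply_def]
  · simp [extL, xch, mergeMap, splitMap, cons, tail, swp, permMap]

/-- Every generator but `xch` ignores the dialect and is its own extension, so only the exchange
requires a factorisation. With `Mic.extL`, this makes the realisers of a join, and hence of an
execution, belong to the microcosm. -/
theorem Mic.extR {φ : X × I → X × I} (hφ : Mic ρ φ) : Mic ρ (extR ρ φ) := by
  have key : ∀ ψ : X → X, IG.extR ρ (fun p => (ψ p.1, p.2)) = fun p => (ψ p.1, p.2) := by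
    intro ψ; funext p; simp [IG.extR]
  refine Mic.induction (P := fun φ => Mic ρ (IG.extR ρ φ)) ?_ ?_ ?_ ?_ ?_ ?_ ?_ hφ
  · intro α r hα; exact (key fun x => (α * x.1 + r, x.2)) ▸ mic_affineMap hα r
  · intro σ hσ; exact (key fun x => (x.1, x.2 ∘ σ)) ▸ mic_permMap hσ
  · have := key fun x => (x.1, mergeSeq ρ x.2)
    exact this ▸ mic_mergeMap
  · have := key fun x => (x.1, (mergeSeq ρ).symm x.2)
    exact this ▸ mic_splitMap
  · rw [extR_xch]; exact mic_xch.comp (mic_mergeMap.comp (mic_xch.comp (mic_splitMap.comp mic_xch)))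
  · rw [extR_id]; exact Mic.id
  · intro φ ψ h1 h2; rw [extR_comp]; exact h1.comp h2

theorem Mic.extL {φ : X × I → X × I} (hφ : Mic ρ φ) : Mic ρ (extL ρ φ) := by
  have key : ∀ ψ : X → X, IG.extL ρ (fun p => (ψ p.1, p.2)) = fun p => (ψ p.1, p.2) := by
    intro ψ; funext p; simp [IG.extL]
  refine Mic.induction (P := fun φ => Mic ρ (IG.extL ρ φ)) ?_ ?_ ?_ ?_ ?_ ?_ ?_ hφ
  · intro α r hα; exact (key fun x => (α * x.1 + r, x.2)) ▸ mic_affineMap hα r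
  · intro σ hσ; exact (key fun x => (x.1, x.2 ∘ σ)) ▸ mic_permMap hσ
  · have := key fun x => (x.1, mergeSeq ρ x.2)
    exact this ▸ mic_mergeMap
  · have := key fun x => (x.1, (mergeSeq ρ).symm x.2)
    exact this ▸ mic_splitMap
  · rw [extL_xch]
    exact mic_xch.comp (mic_mergeMap.comp ((mic_swp 0 1).comp (mic_xch.comp
      ((mic_swp 0 1).comp (mic_splitMap.comp mic_xch)))))
  · rw [extL_id]; exact Mic.id
  · intro φ ψ h1 h2; rw [extL_comp]; exact h1.comp h2

/-! ### Perennisation and `push` in the microcosm -/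

/-- The realiser of the perennisation of an edge. -/
def bangMap (φ : X × I → X × I) (p : X × I) : X × I :=
  (((φ ((p.1.1, tail (tail p.1.2)), p.1.2 0)).1.1,
    cons (φ ((p.1.1, tail (tail p.1.2)), p.1.2 0)).2
      (cons (p.1.2 1) (φ ((p.1.1, tail (tail p.1.2)), p.1.2 0)).1.2)), p.2)

theorem bangMap_comp (φ ψ : X × I → X × I) : bangMap (φ ∘ ψ) = bangMap φ ∘ bangMap ψ := rfl

/-- The permutation of `ℕ` that fixes `0` and `1` and acts as `σ` on the other integers. -/
def shiftTwo (σ : Equiv.Perm ℕ) : Equiv.Perm ℕ where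
  toFun | 0 => 0 | 1 => 1 | n + 2 => σ n + 2
  invFun | 0 => 0 | 1 => 1 | n + 2 => σ.symm n + 2
  left_inv n := by rcases n with _ | _ | n <;> simp
  right_inv n := by rcases n with _ | _ | n <;> simp

/-- After perennisation the old dialect sits at coordinate 0 and the old sequence starts at
coordinate 2. Merging and splitting are therefore conjugated into place by coordinate swaps, and the
exchange becomes the swap of coordinates 0 and 2, with no use of the new dialect. -/
theorem Mic.bangMap {φ : X × I → X × I} (hφ : Mic ρ φ) : Mic ρ (bangMap φ) := by
  refine Mic.induction (P := fun φ => Mic ρ (IG.bangMap φ)) ?_ ?_ ?_ ?_ ?_ ?_ ?_ hφ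
  · intro α r hα
    have : IG.bangMap (affineMap α r) = affineMap α r := by
      funext p
      refine Prod.ext (Prod.ext rfl (funext fun n => ?_)) rfl
      rcases n with _ | _ | n <;> rfl
    rw [this]
    exact mic_affineMap hα r
  · intro σ hσ
    have : IG.bangMap (permMap σ) = permMap (shiftTwo σ) := by
      funext p
      refine Prod.ext (Prod.ext rfl (funext fun n => ?_)) rfl
      rcases n with _ | _ | n <;> rfl
    rw [this]
    refine mic_permMap ((hσ.image (· + 2)).subset fun n hn => ?_)
    rcases n with _ | _ | n
    · exact absurd rfl hn
    · exact absurd rfl hn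
    · exact ⟨n, fun h => hn (congrArg (· + 2) h), rfl⟩
  · have : IG.bangMap (mergeMap ρ) =
        swp 1 2 ∘ swp 0 1 ∘ mergeMap ρ ∘ swp 1 3 ∘ swp 0 2 := by
      funext p
      refine Prod.ext (Prod.ext rfl (funext fun n => ?_)) rfl
      rcases n with _ | _ | _ | n <;>
        simp [IG.bangMap, mergeMap, cons, tail, swp, permMap, Equiv.swap_apply_def]
    rw [this]
    exact (mic_swp 1 2).comp ((mic_swp 0 1).comp (mic_mergeMap.comp
      ((mic_swp 1 3).comp (mic_swp 0 2))))
  · have : IG.bangMap (splitMap ρ) =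
        swp 0 2 ∘ swp 1 3 ∘ splitMap ρ ∘ swp 0 1 ∘ swp 1 2 := by
      funext p
      refine Prod.ext (Prod.ext rfl (funext fun n => ?_)) rfl
      rcases n with _ | _ | _ | _ | n <;>
        simp [IG.bangMap, splitMap, cons, tail, swp, permMap, Equiv.swap_apply_def]
    rw [this]
    exact (mic_swp 0 2).comp ((mic_swp 1 3).comp (mic_splitMap.comp
      ((mic_swp 0 1).comp (mic_swp 1 2))))
  · have : IG.bangMap xch = swp 0 2 := by
      funext p
      refine Prod.ext (Prod.ext rfl (funext fun n => ?_)) rfl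
      rcases n with _ | _ | _ | n <;>
        simp [IG.bangMap, xch, cons, tail, swp, permMap, Equiv.swap_apply_def]
    rw [this]
    exact mic_swp 0 2
  · have : IG.bangMap _root_.id = _root_.id := by
      funext p
      refine Prod.ext (Prod.ext rfl (funext fun n => ?_)) rfl
      rcases n with _ | _ | n <;> rfl
    rw [this]
    exact Mic.id
  · intro φ ψ h1 h2
    rw [bangMap_comp]
    exact h1.comp h2

/-- The sequence evolves from `(x, ρ(y, ρ(z, w)))` through `(ρ(z, w), y, x)` and `(z, w, y, x)` to
`(w, z, x, y)`, and the exchange then trades `w` for the dialect. No affine map occurs, so the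
factorisation gives measure preservation as well as membership in the microcosm. -/
theorem push_eq : (push ρ : X × I → X × I) =
    xch ∘ swp 0 1 ∘ swp 2 3 ∘ splitMap ρ ∘ swp 0 1 ∘ splitMap ρ ∘ swp 0 1 := by
  funext p
  refine Prod.ext (Prod.ext rfl (funext fun n => ?_)) ?_
  · rcases n with _ | _ | _ | _ | n <;>
      simp [push, xch, splitMap, cons, tail, swp, permMap, Equiv.swap_apply_def]
  · simp [push, xch, splitMap, cons, swp, permMap, Equiv.swap_apply_def]

theorem mic_push : Mic ρ (push ρ) := by
  rw [push_eq]
  exact mic_xch.comp ((mic_swp 0 1).comp ((mic_swp 2 3).comp (mic_splitMap.comp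
    ((mic_swp 0 1).comp (mic_splitMap.comp (mic_swp 0 1))))))

theorem measurePreserving_push (hρ : MeasurePreserving ρ) : MeasurePreserving (push ρ) mu mu := by
  rw [push_eq]
  have h := measurePreserving_splitMap hρ
  have hs := fun i j => measurePreserving_permMap (Equiv.swap i j)
  exact measurePreserving_xch.comp ((hs 0 1).comp ((hs 2 3).comp (h.comp
    ((hs 0 1).comp (h.comp (hs 0 1))))))

end IG

namespace IG
namespace Graphing

variable {Ω : Type*} {ρ : (I × I) ≃ᵐ I}

/-! ## Joins and paths -/

theorem join_realiser_mic {F G : Graphing Ω} (hF : F.IsGraphing ρ) (hG : G.IsGraphing ρ)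
    (e : F.Edge ⊕ G.Edge) : Mic ρ ((join ρ F G).realiser e) := by
  cases e with
  | inl e => exact Mic.extR (hF.realiser_mem e)
  | inr e => exact Mic.extL (hG.realiser_mem e)

theorem measurable_dialectFst : Measurable fun p : X × I => (p.1, (ρ.symm p.2).1) := by fun_prop

theorem measurable_dialectSnd : Measurable fun p : X × I => (p.1, (ρ.symm p.2).2) := by fun_prop

theorem measurableSet_join_source {F G : Graphing Ω} (hF : F.IsGraphing ρ) (hG : G.IsGraphing ρ)
    (e : F.Edge ⊕ G.Edge) : MeasurableSet ((join ρ F G).source e) := by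
  cases e with
  | inl e => exact measurable_dialectFst (hF.measurableSet_source e)
  | inr e => exact measurable_dialectSnd (hG.measurableSet_source e)

theorem join_source_subset {F G : Graphing Ω} (hF : F.IsGraphing ρ) (hG : G.IsGraphing ρ)
    {e : F.Edge ⊕ G.Edge} {p : X × I} (hp : p ∈ (join ρ F G).source e) :
    p.1 ∈ F.support ∪ G.support := by
  cases e with
  | inl e => exact Or.inl (hF.source_subset e hp).1
  | inr e => exact Or.inr (hG.source_subset e hp).1

theorem join_target_subset {F G : Graphing Ω} (hF : F.IsGraphing ρ) (hG : G.IsGraphing ρ)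
    {e : F.Edge ⊕ G.Edge} {p : X × I} (hp : p ∈ (join ρ F G).source e) :
    ((join ρ F G).realiser e p).1 ∈ F.support ∪ G.support := by
  cases e with
  | inl e => exact Or.inl (hF.target_subset e ⟨_, hp, rfl⟩).1
  | inr e => exact Or.inr (hG.target_subset e ⟨_, hp, rfl⟩).1

theorem pathRealiser_mic {J : Graphing Ω} (h : ∀ e, Mic ρ (J.realiser e)) (l : List J.Edge) :
    Mic ρ (J.pathRealiser l) := by
  induction l with
  | nil => exact Mic.id
  | cons e l ih => exact ih.comp (h e)

theorem measurableSet_pathSource {J : Graphing Ω} (h : ∀ e, Measurable (J.realiser e))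
    (hs : ∀ e, MeasurableSet (J.source e)) (l : List J.Edge) : MeasurableSet (J.pathSource l) := by
  induction l with
  | nil => exact .univ
  | cons e l ih => exact (hs e).inter (h e ih)

/-- The domain of a path lies in the preimage of the source of each of its edges under the realiser
of the preceding part, and quasi-measure-preserving maps pull null sets back to null sets. -/
theorem pathSource_null {J : Graphing Ω}
    (h : ∀ e, Measure.QuasiMeasurePreserving (J.realiser e) mu mu) {l : List J.Edge} {e : J.Edge}
    (he : e ∈ l) (hnull : mu (J.source e) = 0) : mu (J.pathSource l) = 0 := by
  induction l with
  | nil => simp at he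
  | cons a l ih =>
    rcases List.mem_cons.1 he with rfl | he
    · exact measure_mono_null inter_subset_left hnull
    · exact measure_mono_null inter_subset_right ((h a).preimage_null (ih he))

theorem mem_pathSource_append {J : Graphing Ω} (l l' : List J.Edge) (p : X × I) :
    p ∈ J.pathSource (l ++ l') ↔ p ∈ J.pathSource l ∧ J.pathRealiser l p ∈ J.pathSource l' := by
  induction l generalizing p with
  | nil => simp [pathSource, pathRealiser]
  | cons a l ih =>
    simp only [List.cons_append, pathSource, mem_inter_iff, mem_preimage, ih, and_assoc]
    rfl

theorem pathRealiser_mem {J : Graphing Ω} {S : Set X}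
    (ht : ∀ e, ∀ p ∈ J.source e, (J.realiser e p).1 ∈ S) :
    ∀ l : List J.Edge, l ≠ [] → ∀ p ∈ J.pathSource l, (J.pathRealiser l p).1 ∈ S
  | [], h, _, _ => absurd rfl h
  | [e], _, p, hp => ht e p hp.1
  | _ :: a :: l, _, _, hp => pathRealiser_mem ht (a :: l) (List.cons_ne_nil _ _) _ hp.2

/-- The execution of two graphings is a graphing. -/
theorem IsGraphing.exec [Monoid Ω] (hρ : MeasurePreserving ρ) {F G : Graphing Ω}
    (hF : F.IsGraphing ρ) (hG : G.IsGraphing ρ) : (F.exec ρ G).IsGraphing ρ where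
  measurableSet_support := hF.measurableSet_support.symmDiff hG.measurableSet_support
  measurableSet_source l := by
    have hm := join_realiser_mic hF hG
    have hcut : MeasurableSet (F.support ∩ G.support)ᶜ :=
      (hF.measurableSet_support.inter hG.measurableSet_support).compl
    exact (measurableSet_pathSource (J := join ρ F G) (fun e => ((hm e).quasiMeasurePreserving hρ).measurable)
      (measurableSet_join_source hF hG) l.1).inter
      ((measurable_fst hcut).inter ((measurable_fst.comp
        ((pathRealiser_mic (J := join ρ F G) hm l.1).quasiMeasurePreserving hρ).measurable) hcut))
  source_subset := by
    rintro ⟨l, hl⟩ p ⟨hp, hp1, -⟩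
    refine ⟨?_, trivial⟩
    obtain ⟨e, l, rfl⟩ := List.exists_cons_of_ne_nil hl.1
    have h : p.1 ∈ F.support ∪ G.support := join_source_subset hF hG hp.1
    change _ ∈ symmDiff F.support G.support
    rw [symmDiff_eq_sup_sdiff_inf]
    exact ⟨h, hp1⟩
  realiser_mem l := pathRealiser_mic (J := join ρ F G) (join_realiser_mic hF hG) l.1
  target_subset := by
    rintro ⟨l, hl⟩ _ ⟨p, ⟨hp, -, hp2⟩, rfl⟩
    refine ⟨?_, trivial⟩
    have h := pathRealiser_mem (J := join ρ F G) (S := F.support ∪ G.support)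
      (fun e p hp => join_target_subset hF hG hp) l hl.1 p hp
    change _ ∈ symmDiff F.support G.support
    rw [symmDiff_eq_sup_sdiff_inf]
    exact ⟨h, hp2⟩

theorem join_realiser_qmp (hρ : MeasurePreserving ρ) {F G : Graphing Ω} (hF : F.IsGraphing ρ)
    (hG : G.IsGraphing ρ) (e : F.Edge ⊕ G.Edge) :
    Measure.QuasiMeasurePreserving ((join ρ F G).realiser e) mu mu :=
  (join_realiser_mic hF hG e).quasiMeasurePreserving hρ

/-! ## Invariance of the measurement -/

section Transfer

variable {J J' : Graphing Ω} {Ψ : X × I ≃ᵐ X × I} {j : J'.Edge → J.Edge}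

theorem pathRealiser_transfer
    (hreal : ∀ e p, J.realiser (j e) (Ψ p) = Ψ (J'.realiser e p)) (l : List J'.Edge) (p : X × I) :
    J.pathRealiser (l.map j) (Ψ p) = Ψ (J'.pathRealiser l p) := by
  induction l generalizing p with
  | nil => rfl
  | cons a l ih =>
    simp only [List.map_cons, pathRealiser, Function.comp_apply, hreal, ih]

theorem pathSource_transfer (hsrc : ∀ e p, Ψ p ∈ J.source (j e) ↔ p ∈ J'.source e)
    (hreal : ∀ e p, J.realiser (j e) (Ψ p) = Ψ (J'.realiser e p)) (l : List J'.Edge) (p : X × I) :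
    Ψ p ∈ J.pathSource (l.map j) ↔ p ∈ J'.pathSource l := by
  induction l generalizing p with
  | nil => simp [pathSource]
  | cons a l ih =>
    simp only [List.map_cons, pathSource, mem_inter_iff, mem_preimage, hreal, ih, hsrc]

theorem pathWeight_transfer [Monoid Ω] (hw : ∀ e, J.weight (j e) = J'.weight e) (l : List J'.Edge) :
    J.pathWeight (l.map j) = J'.pathWeight l := by
  induction l with
  | nil => rfl
  | cons a l ih => simp only [List.map_cons, pathWeight, hw, ih]

/-- `Ψ` conjugates the two path realisers, so orbits, their lengths and the path domains correspond;
what remains is a change of variables in the integral. -/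
theorem cycleMeas_transfer [Monoid Ω] (m : Ω → ℝ≥0∞) (hΨ : MeasurePreserving Ψ mu mu)
    (hsrc : ∀ e p, Ψ p ∈ J.source (j e) ↔ p ∈ J'.source e)
    (hreal : ∀ e p, J.realiser (j e) (Ψ p) = Ψ (J'.realiser e p))
    (hw : ∀ e, J.weight (j e) = J'.weight e) (l : List J'.Edge) :
    cycleMeas m J' l = cycleMeas m J (l.map j) := by
  have hsemi : Function.Semiconj Ψ (J'.pathRealiser l) (J.pathRealiser (l.map j)) :=
    fun p => (pathRealiser_transfer hreal l p).symm
  have hper : ∀ n p, Function.IsPeriodicPt (J'.pathRealiser l) n p ↔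
      Function.IsPeriodicPt (J.pathRealiser (l.map j)) n (Ψ p) := fun n p => by
    simp only [Function.IsPeriodicPt, Function.IsFixedPt, ← (hsemi.iterate_right n).eq,
      Ψ.injective.eq_iff]
  have hmin : ∀ p, Function.minimalPeriod (J'.pathRealiser l) p =
      Function.minimalPeriod (J.pathRealiser (l.map j)) (Ψ p) := fun p =>
    Function.minimalPeriod_eq_minimalPeriod_iff.2 fun n => hper n p
  have hsupp : J'.cycleSupport l = Ψ ⁻¹' J.cycleSupport (l.map j) := by
    ext p
    simp only [cycleSupport, mem_preimage, Function.periodicPts, mem_ofPred_eq, hper,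
      ← (hsemi.iterate_right _).eq, pathSource_transfer hsrc hreal]
  simp only [cycleMeas, hsupp, hmin, ← pathWeight_transfer hw]
  exact hΨ.setLIntegral_comp_preimage_emb Ψ.measurableEmbedding
    (fun x => m (J.pathWeight (l.map j) ^ Function.minimalPeriod (J.pathRealiser (l.map j)) x) /
      (Function.minimalPeriod (J.pathRealiser (l.map j)) x : ℝ≥0∞)) _

end Transfer

theorem isAltCycle_map_iff {E₁ E₂ E₁' E₂' : Type} {j : E₁' ⊕ E₂' → E₁ ⊕ E₂}
    (hj : Function.Injective j) (halt : ∀ a b, Alternates (j a) (j b) ↔ Alternates a b)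
    (l : List (E₁' ⊕ E₂')) : IsAltCycle (l.map j) ↔ IsAltCycle l := by
  unfold IsAltCycle
  rw [← List.map_append, List.isChain_map]
  refine and_congr (by simp) (and_congr (by simp only [halt]) ⟨fun h c n hc => ?_, fun h c n hc => ?_⟩)
  · refine h (c.map j) n ?_
    rw [hc, List.map_flatten, List.map_replicate]
  -- The zeroth power is empty whatever `c` is, so `c` need not be a word in the image of `j`; this
  -- case is settled with the empty word.
  · rcases Nat.eq_zero_or_pos n with rfl | hn
    · exact h [] 0 (by simpa using hc)
    · have hcr : ∀ e ∈ c, e ∈ range j := by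
        intro e he
        have : e ∈ l.map j := by
          rw [hc]
          exact List.mem_flatten.2 ⟨c, List.mem_replicate.2 ⟨hn.ne', rfl⟩, he⟩
        obtain ⟨a, -, rfl⟩ := List.mem_map.1 this
        exact ⟨a, rfl⟩
      obtain ⟨c', rfl⟩ : c ∈ range (List.map j) := by
        rw [range_list_map]; exact hcr
      refine h c' n (hj.list_map ?_)
      rw [hc, List.map_flatten, List.map_replicate]

variable [Monoid Ω]

/-- The measurement does not change under a measure-preserving change of coordinates, a renaming
of edges, and the addition of edges of negligible source. -/
theorem meas_transfer (m : Ω → ℝ≥0∞) {F G F' G' : Graphing Ω} (Ψ : X × I ≃ᵐ X × I)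
    (hΨ : MeasurePreserving Ψ mu mu) (j : F'.Edge ⊕ G'.Edge → F.Edge ⊕ G.Edge)
    (hj : Function.Injective j) (halt : ∀ a b, Alternates (j a) (j b) ↔ Alternates a b)
    (hnull : ∀ e ∉ range j, mu ((join ρ F G).source e) = 0)
    (hqmp : ∀ e, Measure.QuasiMeasurePreserving ((join ρ F G).realiser e) mu mu)
    (hsrc : ∀ e p, Ψ p ∈ (join ρ F G).source (j e) ↔ p ∈ (join ρ F' G').source e)
    (hreal : ∀ e p, (join ρ F G).realiser (j e) (Ψ p) = Ψ ((join ρ F' G').realiser e p))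
    (hw : ∀ e, (join ρ F G).weight (j e) = (join ρ F' G').weight e) :
    meas ρ m F' G' = meas ρ m F G := by
  let g : {l : List (F'.Edge ⊕ G'.Edge) // IsAltCycle l} → {l : List (F.Edge ⊕ G.Edge) // IsAltCycle l} :=
    fun l => ⟨l.1.map j, (isAltCycle_map_iff hj halt l.1).2 l.2⟩
  have hg : Function.Injective g := fun a b h =>
    Subtype.ext (hj.list_map (congrArg Subtype.val h))
  unfold meas
  rw [← hg.tsum_eq]
  · refine tsum_congr fun l => ?_
    rw [cycleMeas_transfer (J := join ρ F G) (J' := join ρ F' G') m hΨ hsrc hreal hw l.1]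
    rw [show (g l).1.length = l.1.length from List.length_map _]
    rfl
  -- A cycle outside the image of `g` uses an edge outside the range of `j`, of negligible source,
  -- so its term vanishes.
  · intro l hl
    by_contra hl'
    refine hl ?_
    have : ∃ e ∈ l.1, e ∉ range j := by
      by_contra! hcon
      obtain ⟨c, hc⟩ : l.1 ∈ range (List.map j) := by
        rw [range_list_map]; exact hcon
      exact hl' ⟨⟨c, (isAltCycle_map_iff hj halt c).1 (hc ▸ l.2)⟩, Subtype.ext hc⟩
    obtain ⟨e, he, hej⟩ := this
    have h0 : mu ((join ρ F G).cycleSupport l.1) = 0 :=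
      measure_mono_null (fun p hp => hp.2 0) (pathSource_null hqmp he (hnull e hej))
    simp [cycleMeas, setLIntegral_measure_zero _ _ h0]

theorem alternates_sumMap {E₁ E₂ E₁' E₂' : Type} (f : E₁' → E₁) (g : E₂' → E₂)
    (a b : E₁' ⊕ E₂') : Alternates (Sum.map f g a) (Sum.map f g b) ↔ Alternates a b := by
  cases a <;> cases b <;> simp [Alternates]

theorem alternates_swap {E₁ E₂ : Type} (a b : E₁ ⊕ E₂) :
    Alternates a.swap b.swap ↔ Alternates a b := by
  cases a <;> cases b <;> simp [Alternates]

/-- The measurement is symmetric. -/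
theorem meas_comm (hρ : MeasurePreserving ρ) (m : Ω → ℝ≥0∞) {F G : Graphing Ω}
    (hF : F.IsGraphing ρ) (hG : G.IsGraphing ρ) : meas ρ m F G = meas ρ m G F := by
  let σ : X × I ≃ᵐ X × I := (MeasurableEquiv.refl X).prodCongr
    (ρ.symm.trans (MeasurableEquiv.prodComm.trans ρ))
  have hσ : MeasurePreserving σ mu mu :=
    (MeasurePreserving.id muX).prod
      (hρ.comp (Measure.measurePreserving_swap.comp (hρ.symm ρ)))
  have hσa : ∀ p, σ p = (p.1, ρ ((ρ.symm p.2).2, (ρ.symm p.2).1)) := fun p => rfl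
  clear_value σ
  refine meas_transfer m σ hσ Sum.swap Sum.swap_leftInverse.injective alternates_swap ?_
    (join_realiser_qmp hρ hG hF) ?_ ?_ ?_
  · intro e he; exact absurd ⟨e.swap, Sum.swap_swap e⟩ he
  · rintro (e | e) p <;> simp [hσa, join, extLeft, extRight]
  · rintro (e | e) p <;> simp [hσa, join, extLeft, extRight]
  · rintro (e | e) <;> rfl

/-- The measurement only depends on the class of a graphing up to renaming of edges and up to
negligible edges. -/
theorem meas_congr (hρ : MeasurePreserving ρ) (m : Ω → ℝ≥0∞) {F F' G : Graphing Ω}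
    (hF : F.IsGraphing ρ) (hF' : F'.IsGraphing ρ) (hG : G.IsGraphing ρ) (h : F.Equivalent F') :
    meas ρ m F G = meas ρ m F' G := by
  obtain ⟨-, f, hf⟩ := h
  -- `R` keeps the non-negligible edges of `F`. It embeds into `F` by inclusion and into `F'`
  -- through `f`, missing only negligible edges in both, so both measurements agree with that of
  -- `R`.
  let R : Graphing Ω :=
    { support := F.support, Edge := {e : F.Edge // mu (F.source e) ≠ 0},
      source := fun e => F.source e.1, realiser := fun e => F.realiser e.1,
      weight := fun e => F.weight e.1 }
  have hnull : ∀ {H : Graphing Ω} (_ : H.IsGraphing ρ) (i : R.Edge → H.Edge)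
      (_ : ∀ e, mu (H.source e) ≠ 0 → e ∈ range i) (e : H.Edge ⊕ G.Edge)
      (_ : e ∉ range (Sum.map i (id : G.Edge → G.Edge))), mu ((join ρ H G).source e) = 0 := by
    rintro H hH i hi (e | e) he
    · have : e ∉ range i := fun ⟨a, ha⟩ => he ⟨Sum.inl a, by simp [ha]⟩
      have h0 : mu (H.source e) = 0 := by by_contra h0; exact this (hi e h0)
      have hmp : Measure.QuasiMeasurePreserving (fun p : X × I => (p.1, (ρ.symm p.2).1)) mu mu :=
        QuasiMeasurePreserving.prodMap (Measure.QuasiMeasurePreserving.id muX)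
          (Measure.quasiMeasurePreserving_fst.comp (hρ.symm ρ).quasiMeasurePreserving)
      exact hmp.preimage_null h0
    · exact absurd ⟨Sum.inr e, rfl⟩ he
  trans meas ρ m R G
  · symm
    refine meas_transfer m (MeasurableEquiv.refl _) (MeasurePreserving.id mu)
      (Sum.map Subtype.val id) (Sum.map_injective.2 ⟨Subtype.val_injective, Function.injective_id⟩)
      (alternates_sumMap _ _)
      (hnull hF _ fun e he => ⟨⟨e, he⟩, rfl⟩) (join_realiser_qmp hρ hF hG) ?_ ?_ ?_
    · rintro (e | e) p <;> rfl
    · rintro (e | e) p <;> rfl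
    · rintro (e | e) <;> rfl
  · refine meas_transfer m (MeasurableEquiv.refl _) (MeasurePreserving.id mu)
      (Sum.map (fun e => (f e).1) id) (Sum.map_injective.2
        ⟨Subtype.val_injective.comp f.injective, Function.injective_id⟩)
      (alternates_sumMap _ _)
      (hnull hF' _ fun e he => ⟨f.symm ⟨e, he⟩, by simp⟩) (join_realiser_qmp hρ hF' hG) ?_ ?_ ?_
    · rintro (e | e) p
      · change (p.1, (ρ.symm p.2).1) ∈ F'.source (f e).1 ↔ _ ∈ F.source e.1
        rw [(hf e).1]
      · rfl
    · rintro (e | e) p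
      · change extR ρ (F'.realiser (f e).1) p = extR ρ (F.realiser e.1) p
        rw [(hf e).2.1]
      · rfl
    · rintro (e | e)
      · exact (hf e).2.2
      · rfl

end Graphing
end IG

namespace IG
namespace Graphing

variable {Ω : Type*} {ρ : (I × I) ≃ᵐ I}

/-! ## Images of graphings under bijections -/

theorem mem_conj_source {B : (X × I) ≃ (X × I)} {G : Graphing Ω} {e : G.Edge} {p : X × I} :
    p ∈ (G.conj B).source e ↔ B.symm p ∈ G.source e := by
  exact ⟨fun ⟨_, hq, h⟩ => h ▸ by rwa [B.symm_apply_apply], fun h => ⟨_, h, B.apply_symm_apply p⟩⟩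

theorem fst_image_eq {B : (X × I) ≃ (X × I)} {W U : Set X} (h : ∀ p, (B p).1 ∈ U ↔ p.1 ∈ W) :
    Prod.fst '' (B '' (W ×ˢ univ)) = U := by
  ext x
  constructor
  · rintro ⟨_, ⟨p, hp, rfl⟩, rfl⟩
    exact (h p).2 hp.1
  · intro hx
    refine ⟨(x, 0), ⟨B.symm (x, 0), ⟨(h _).1 ?_, trivial⟩, B.apply_symm_apply _⟩, rfl⟩
    rwa [B.apply_symm_apply]

theorem IsGraphing.conj {G : Graphing Ω} (hG : G.IsGraphing ρ) (B : (X × I) ≃ᵐ (X × I))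
    (hB : Mic ρ B) {U : Set X} (hU : MeasurableSet U)
    (h : ∀ p, (B p).1 ∈ U ↔ p.1 ∈ G.support) : (G.conj B.toEquiv).IsGraphing ρ := by
  have hsupp : (G.conj B.toEquiv).support = U := fst_image_eq (B := B.toEquiv) h
  have hB' : Mic ρ B.toEquiv.symm := Mic.symm (B := B.toEquiv) hB
  refine ⟨hsupp ▸ hU, fun e => ?_, fun e => ?_, fun e => ?_, fun e => ?_⟩
  · exact B.measurableSet_image.2 (hG.measurableSet_source e)
  · rintro _ ⟨p, hp, rfl⟩
    rw [hsupp]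
    exact ⟨(h p).2 (hG.source_subset e hp).1, trivial⟩
  · exact hB.comp (Mic.comp (hG.realiser_mem e) hB')
  · rintro _ ⟨_, ⟨p, hp, rfl⟩, rfl⟩
    rw [hsupp]
    refine ⟨?_, trivial⟩
    change (B (G.realiser e (B.symm (B p)))).1 ∈ U
    rw [B.symm_apply_apply, h]
    exact (hG.target_subset e ⟨p, hp, rfl⟩).1

theorem IsGraphing.extLeft {G : Graphing Ω} (hG : G.IsGraphing ρ) :
    (G.extLeft ρ).IsGraphing ρ where
  measurableSet_support := hG.measurableSet_support
  measurableSet_source e := measurable_dialectSnd (hG.measurableSet_source e)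
  source_subset e _ hp := ⟨(hG.source_subset e hp).1, trivial⟩
  realiser_mem e := Mic.extL (hG.realiser_mem e)
  target_subset e := by
    rintro _ ⟨p, hp, rfl⟩
    exact ⟨(hG.target_subset e ⟨_, hp, rfl⟩).1, trivial⟩

/-! ### Moving a graphing along a bijection that acts on the dialect -/

/-- The extension of a bijection of `X × [0,1]` by an unused second dialect. -/
def extEquiv (ρ : (I × I) ≃ᵐ I) (K : (X × I) ≃ᵐ (X × I)) : (X × I) ≃ᵐ (X × I) where
  toFun := extR ρ K
  invFun := extR ρ K.symm
  left_inv p := by simp [extR]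
  right_inv p := by simp [extR]
  measurable_toFun := by change Measurable (extR ρ K); unfold extR; fun_prop
  measurable_invFun := by change Measurable (extR ρ K.symm); unfold extR; fun_prop

/-- The graphing `G`, acting on the space moved along `K`, where the dialect of `K` is carried along
as a first, unused dialect of `G`. -/
def along (ρ : (I × I) ≃ᵐ I) (K : (X × I) ≃ᵐ (X × I)) (G : Graphing Ω) : Graphing Ω :=
  (G.extLeft ρ).conj (extEquiv ρ K).toEquiv

theorem along_support {K : (X × I) ≃ᵐ (X × I)} {G : Graphing Ω} {U : Set X}
    (h : ∀ p, (K p).1 ∈ U ↔ p.1 ∈ G.support) : (along ρ K G).support = U :=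
  fst_image_eq (B := (extEquiv ρ K).toEquiv) fun _ => h _

theorem IsGraphing.along {G : Graphing Ω} (hG : G.IsGraphing ρ) {K : (X × I) ≃ᵐ (X × I)}
    (hK : Mic ρ K) {U : Set X} (hU : MeasurableSet U)
    (h : ∀ p, (K p).1 ∈ U ↔ p.1 ∈ G.support) : (along ρ K G).IsGraphing ρ :=
  hG.extLeft.conj (extEquiv ρ K) (Mic.extR hK) hU fun _ => h _

theorem mem_along_source {K : (X × I) ≃ᵐ (X × I)} {G : Graphing Ω} {e : G.Edge} {p : X × I} :
    p ∈ (along ρ K G).source e ↔ extR ρ K.symm p ∈ (G.extLeft ρ).source e :=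
  mem_conj_source

theorem along_realiser {K : (X × I) ≃ᵐ (X × I)} {G : Graphing Ω} (e : G.Edge) (p : X × I) :
    (along ρ K G).realiser e p = extR ρ K (extL ρ (G.realiser e) (extR ρ K.symm p)) := rfl

/-- The isomorphism `I ≃ I × (I × I)` along which `ρ (x, ρ (y, z))` corresponds to
`(y, (x, z))`. -/
def dialectSplit (ρ : (I × I) ≃ᵐ I) : I ≃ᵐ I × (I × I) :=
  ρ.symm.trans <| ((MeasurableEquiv.refl I).prodCongr ρ.symm).trans <|
    MeasurableEquiv.prodAssoc.symm.trans <|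
      (MeasurableEquiv.prodComm.prodCongr (MeasurableEquiv.refl I)).trans MeasurableEquiv.prodAssoc

/-- The isomorphism `(x, (y, z)) ↦ ρ (ρ (x, y), z)`. -/
def dialectMerge (ρ : (I × I) ≃ᵐ I) : I × (I × I) ≃ᵐ I :=
  MeasurableEquiv.prodAssoc.symm.trans <| (ρ.prodCongr (MeasurableEquiv.refl I)).trans ρ

theorem measurePreserving_dialectSplit (hρ : MeasurePreserving ρ) :
    MeasurePreserving (dialectSplit ρ) volume
      ((volume : Measure I).prod ((volume : Measure I).prod (volume : Measure I))) := by
  have hs := hρ.symm ρ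
  have ha := measurePreserving_prodAssoc (volume : Measure I) (volume : Measure I)
    (volume : Measure I)
  exact ha.comp ((Measure.measurePreserving_swap.prod (MeasurePreserving.id _)).comp
    ((ha.symm MeasurableEquiv.prodAssoc).comp (((MeasurePreserving.id _).prod hs).comp hs)))

theorem measurePreserving_dialectMerge (hρ : MeasurePreserving ρ) :
    MeasurePreserving (dialectMerge ρ)
      ((volume : Measure I).prod ((volume : Measure I).prod (volume : Measure I))) volume := by
  have ha := measurePreserving_prodAssoc (volume : Measure I) (volume : Measure I)
    (volume : Measure I)
  exact hρ.comp ((hρ.prod (MeasurePreserving.id _)).comp (ha.symm MeasurableEquiv.prodAssoc))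

/-- The change of coordinates `(p, ρ (e, ρ (h, g))) ↦ (q, ρ (ρ (f, e), g))`, where
`K (p, h) = (q, f)`. -/
def alongEquiv (ρ : (I × I) ≃ᵐ I) (K : (X × I) ≃ᵐ (X × I)) : X × I ≃ᵐ X × I :=
  ((MeasurableEquiv.refl X).prodCongr (dialectSplit ρ)).trans <|
    MeasurableEquiv.prodAssoc.symm.trans <| (K.prodCongr (MeasurableEquiv.refl _)).trans <|
      MeasurableEquiv.prodAssoc.trans <| (MeasurableEquiv.refl X).prodCongr (dialectMerge ρ)

theorem alongEquiv_apply (K : (X × I) ≃ᵐ (X × I)) (p : X) (e h g : I) :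
    alongEquiv ρ K (p, ρ (e, ρ (h, g))) = ((K (p, h)).1, ρ (ρ ((K (p, h)).2, e), g)) := by
  have : dialectSplit ρ (ρ (e, ρ (h, g))) = (h, (e, g)) := by
    change ((ρ.symm (ρ.symm (ρ (e, ρ (h, g)))).2).1, ((ρ.symm (ρ (e, ρ (h, g)))).1,
      (ρ.symm (ρ.symm (ρ (e, ρ (h, g)))).2).2)) = _
    simp
  change ((K (p, (dialectSplit ρ (ρ (e, ρ (h, g)))).1)).1,
    ρ (ρ ((K (p, (dialectSplit ρ (ρ (e, ρ (h, g)))).1)).2,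
      (dialectSplit ρ (ρ (e, ρ (h, g)))).2.1), (dialectSplit ρ (ρ (e, ρ (h, g)))).2.2)) = _
  rw [this]

theorem measurePreserving_alongEquiv (hρ : MeasurePreserving ρ) {K : (X × I) ≃ᵐ (X × I)}
    (hK : MeasurePreserving K mu mu) : MeasurePreserving (alongEquiv ρ K) mu mu := by
  have ha := measurePreserving_prodAssoc muX (volume : Measure I)
    ((volume : Measure I).prod (volume : Measure I))
  exact ((MeasurePreserving.id muX).prod (measurePreserving_dialectMerge hρ)).comp
    (ha.comp ((hK.prod (MeasurePreserving.id _)).comp ((ha.symm MeasurableEquiv.prodAssoc).comp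
      ((MeasurePreserving.id muX).prod (measurePreserving_dialectSplit hρ)))))

/-- Moving the first graphing along `K` amounts to moving the second one along the inverse. -/
theorem meas_along [Monoid Ω] (hρ : MeasurePreserving ρ) (m : Ω → ℝ≥0∞) {K : (X × I) ≃ᵐ (X × I)}
    (hK : MeasurePreserving K mu mu) {F G : Graphing Ω} (hF : (along ρ K F).IsGraphing ρ)
    (hG : G.IsGraphing ρ) : meas ρ m F (along ρ K.symm G) = meas ρ m (along ρ K F) G := by
  have hsurj : ∀ P : X × I → Prop, (∀ x e h g, P (x, ρ (e, ρ (h, g)))) → ∀ p, P p := by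
    rintro P hP ⟨x, t⟩
    have := hP x (ρ.symm t).1 (ρ.symm (ρ.symm t).2).1 (ρ.symm (ρ.symm t).2).2
    simpa using this
  -- On the left the joint dialect is `ρ(e, ρ(h, g))`, with `e` for `F`, `g` for `G` and `h` the
  -- dialect carried by `K⁻¹`; on the right it is `ρ(ρ(f, e), g)`, with `f` carried by `K`. Sending
  -- `(p, h)` through `K` and regrouping matches the edges of both graphings at once.
  refine meas_transfer (F := along ρ K F) (F' := F) (G' := along ρ K.symm G) m (alongEquiv ρ K)
    (measurePreserving_alongEquiv hρ hK) id Function.injective_id (fun _ _ => Iff.rfl)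
    (fun e he => absurd ⟨e, rfl⟩ he) (join_realiser_qmp hρ hF hG) ?_ ?_ ?_
  · rintro (e | e) <;> refine hsurj _ fun x e' h g => ?_ <;> rw [alongEquiv_apply]
    · change _ ∈ (along ρ K F).source e ↔ _ ∈ F.source e
      rw [mem_along_source]
      simp [extR, extLeft]
    · refine Iff.trans ?_ mem_along_source.symm
      change ((K (x, h)).1, (ρ.symm (ρ (ρ ((K (x, h)).2, e'), g))).2) ∈ G.source e ↔ _
      simp [extR, extLeft]
  · rintro (e | e) <;> refine hsurj _ fun x e' h g => ?_ <;> rw [alongEquiv_apply]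
    · change extR ρ ((along ρ K F).realiser e) _ = alongEquiv ρ K (extR ρ (F.realiser e) _)
      simp [extR, extL, along_realiser, alongEquiv_apply]
    · change extL ρ (G.realiser e) _ = alongEquiv ρ K (extL ρ
        (fun p => extR ρ K.symm (extL ρ (G.realiser e) (extR ρ K.symm.symm p))) _)
      simp [extR, extL, alongEquiv_apply]
  · rintro (e | e) <;> rfl

theorem Equivalent.symm {F G : Graphing Ω} (h : F.Equivalent G) : G.Equivalent F := by
  obtain ⟨hs, f, hf⟩ := h
  refine ⟨hs.symm, f.symm, fun e => ?_⟩
  obtain ⟨e, rfl⟩ := f.surjective e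
  rw [f.symm_apply_apply]
  exact ⟨(hf e).1.symm, (hf e).2.1.symm, (hf e).2.2.symm⟩

/-! ## The transposition along a bijection -/

variable [Monoid Ω]

/-- The graphing with the two mutually reverse edges given by a bijection `K` that maps `W` onto
`U`: the edge `true` is `K`, from `W` to `U`, and the edge `false` is its inverse. -/
def transposition (Ω : Type*) [Monoid Ω] (K : (X × I) ≃ᵐ (X × I)) (W U : Set X) : Graphing Ω where
  support := W ∪ U
  Edge := Bool
  source b := (bif b then W else U) ×ˢ univ
  realiser b := bif b then K else K.symm
  weight _ := 1

section Transposition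

variable {K : (X × I) ≃ᵐ (X × I)} {W U : Set X}

theorem transposition_isGraphing (hK : Mic ρ K) (hW : MeasurableSet W) (hU : MeasurableSet U)
    (h : ∀ p, (K p).1 ∈ U ↔ p.1 ∈ W) : (transposition Ω K W U).IsGraphing ρ where
  measurableSet_support := hW.union hU
  measurableSet_source b := by cases b; exacts [hU.prod .univ, hW.prod .univ]
  source_subset b := by
    rintro p ⟨hp, -⟩
    cases b
    exacts [⟨Or.inr hp, trivial⟩, ⟨Or.inl hp, trivial⟩]
  realiser_mem b := by
    cases b
    exacts [Mic.symm (B := K.toEquiv) hK, hK]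
  target_subset b := by
    rintro _ ⟨p, ⟨hp, -⟩, rfl⟩
    cases b
    · exact ⟨Or.inl ((h _).1 (by simpa [transposition] using hp)), trivial⟩
    · exact ⟨Or.inr ((h _).2 hp), trivial⟩

theorem transposition_isUnionOfTranspositions (h : ∀ p, (K p).1 ∈ U ↔ p.1 ∈ W)
    (hd : Disjoint W U) : (transposition Ω K W U).IsUnionOfTranspositions := by
  have him : K '' (W ×ˢ univ) = U ×ˢ univ := by
    ext p
    rw [K.image_eq_preimage_symm]
    simp [← h]
  have him' : K.symm '' (U ×ˢ univ) = W ×ˢ univ := by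
    rw [← him]; exact K.toEquiv.symm_image_image _
  have hd' : Disjoint (W ×ˢ (univ : Set I)) (U ×ˢ univ) :=
    Set.disjoint_left.2 fun p hp hp' => Set.disjoint_left.1 hd hp.1 hp'.1
  refine ⟨fun b => ?_, fun b b' hb => ?_⟩
  · cases b
    · exact ⟨true, Bool.noConfusion, him'.symm, K.apply_symm_apply, K.symm_apply_apply⟩
    · exact ⟨false, Bool.noConfusion, him.symm, K.symm_apply_apply, K.apply_symm_apply⟩
  · cases b <;> cases b'
    exacts [absurd rfl hb, hd'.symm, hd', absurd rfl hb]

variable {B : Graphing Ω}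

theorem fst_mem_of_mem_inl_true {p : X × I}
    (hp : p ∈ (join ρ (transposition Ω K W U) B).source (Sum.inl true)) : p.1 ∈ W := hp.1

theorem fst_mem_of_mem_inl_false {p : X × I}
    (hp : p ∈ (join ρ (transposition Ω K W U) B).source (Sum.inl false)) : p.1 ∈ U := hp.1

theorem fst_target_inl_true (h : ∀ p, (K p).1 ∈ U ↔ p.1 ∈ W) {p : X × I} (hp : p.1 ∈ W) :
    ((join ρ (transposition Ω K W U) B).realiser (Sum.inl true) p).1 ∈ U := (h _).2 hp

theorem fst_target_inl_false (h : ∀ p, (K p).1 ∈ U ↔ p.1 ∈ W) {p : X × I} (hp : p.1 ∈ U) :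
    ((join ρ (transposition Ω K W U) B).realiser (Sum.inl false) p).1 ∈ W := by
  refine (h (K.symm (p.1, (ρ.symm p.2).1))).1 ?_
  rwa [K.apply_symm_apply]

theorem fst_mem_of_mem_inr (hB : B.IsGraphing ρ) (hBW : B.support = W) {e : B.Edge} {p : X × I}
    (hp : p ∈ (join ρ (transposition Ω K W U) B).source (Sum.inr e)) : p.1 ∈ W :=
  hBW ▸ (hB.source_subset e hp).1

theorem fst_target_inr (hB : B.IsGraphing ρ) (hBW : B.support = W) {e : B.Edge} {p : X × I}
    (hp : p ∈ (join ρ (transposition Ω K W U) B).source (Sum.inr e)) :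
    ((join ρ (transposition Ω K W U) B).realiser (Sum.inr e) p).1 ∈ W :=
  hBW ▸ (hB.target_subset e ⟨_, hp, rfl⟩).1

/-- An edge of `B` ends over `W`. From there `K⁻¹` is undefined, and `K` leads to `U`, which is
disjoint from the support of `B`. -/
theorem notMem_pathSource_inr_inl_inr (h : ∀ p, (K p).1 ∈ U ↔ p.1 ∈ W) (hd : Disjoint W U)
    (hB : B.IsGraphing ρ) (hBW : B.support = W) (a c : B.Edge) (b : Bool)
    (l : List (Bool ⊕ B.Edge)) (p : X × I) :
    p ∉ (join ρ (transposition Ω K W U) B).pathSource (Sum.inr a :: Sum.inl b :: Sum.inr c :: l) := by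
  rintro ⟨h1, h2, h3, -⟩
  have h4 := fst_target_inr hB hBW h1
  cases b
  · exact Set.disjoint_left.1 hd h4 (fst_mem_of_mem_inl_false h2)
  · exact Set.disjoint_left.1 hd (fst_mem_of_mem_inr hB hBW h3) (fst_target_inl_true h h4)

/-- Among any four alternating edges, either the first three or the last three form the impossible
pattern `B`, wire, `B`. -/
theorem notMem_pathSource_of_length (h : ∀ p, (K p).1 ∈ U ↔ p.1 ∈ W) (hd : Disjoint W U)
    (hB : B.IsGraphing ρ) (hBW : B.support = W) (p : X × I) :
    ∀ l : List (Bool ⊕ B.Edge), l.IsChain Alternates → 4 ≤ l.length →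
      p ∉ (join ρ (transposition Ω K W U) B).pathSource l
  | [], _, hl | [_], _, hl | [_, _], _, hl | [_, _, _], _, hl => by simp at hl
  | a :: b :: c :: d :: l, hc, _ => by
    simp only [List.isChain_cons_cons, Alternates] at hc
    obtain ⟨h1, h2, h3, -⟩ := hc
    rcases a with a | a <;> rcases b with b | b <;> simp at h1 <;>
      rcases c with c | c <;> simp at h2 <;> rcases d with d | d <;> simp at h3
    · exact fun hp => notMem_pathSource_inr_inl_inr h hd hB hBW b d c l _ hp.2
    · exact notMem_pathSource_inr_inl_inr h hd hB hBW a c b _ p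

theorem IsAltCycle.four_le_length {E E' : Type} :
    ∀ {l : List (E ⊕ E')}, IsAltCycle l → 4 ≤ (l ++ l).length
  | [], hl => absurd rfl hl.1
  | [a], hl => by have := hl.2.1; simp [Alternates] at this
  | _ :: _ :: _, _ => by rw [List.length_append]; simp only [List.length_cons]; omega

/-- A point in the support of a cycle can run through it twice. Since alternation excludes length 1,
this traces an alternating path of at least four edges, whose domain is empty. -/
theorem meas_transposition (m : Ω → ℝ≥0∞) (h : ∀ p, (K p).1 ∈ U ↔ p.1 ∈ W) (hd : Disjoint W U)
    (hB : B.IsGraphing ρ) (hBW : B.support = W) : meas ρ m (transposition Ω K W U) B = 0 := by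
  refine ENNReal.tsum_eq_zero.2 fun l => ?_
  have : (join ρ (transposition Ω K W U) B).cycleSupport l.1 = ∅ := by
    refine eq_empty_of_forall_notMem fun p hp => ?_
    refine notMem_pathSource_of_length h hd hB hBW p (l.1 ++ l.1) l.2.2.1 l.2.four_le_length
      ((mem_pathSource_append _ _ _).2 ⟨hp.2 0, hp.2 1⟩)
  simp [cycleMeas, this]

/-- The paths that contribute to the execution of a transposition along `K` and a graphing on its
first side: an edge of the graphing, conjugated by `K`. -/
def conjPath (e : B.Edge) : List ((transposition Ω K W U).Edge ⊕ B.Edge) :=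
  [Sum.inl false, Sum.inr e, Sum.inl true]

theorem cut_eq (hBW : B.support = W) : (transposition Ω K W U).support ∩ B.support = W := by
  rw [hBW]; exact inter_eq_right.2 subset_union_left

/-- The cut conditions are automatic, since such a path starts and ends over `U`. The sources agree
exactly, not merely up to null sets, as `Equivalent` demands. -/
theorem along_source_eq (h : ∀ p, (K p).1 ∈ U ↔ p.1 ∈ W) (hd : Disjoint W U)
    (hB : B.IsGraphing ρ) (hBW : B.support = W) (e : B.Edge) :
    (along ρ K B).source e =
      (join ρ (transposition Ω K W U) B).pathSource (conjPath e) ∩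
      {p | p.1 ∉ (transposition Ω K W U).support ∩ B.support ∧
        ((join ρ (transposition Ω K W U) B).pathRealiser (conjPath e) p).1 ∉
          (transposition Ω K W U).support ∩ B.support} := by
  rw [cut_eq hBW]
  ext p
  rw [mem_along_source]
  constructor
  · intro hp
    have h1 : (extR ρ K.symm p).1 ∈ W := hBW ▸ (hB.source_subset e hp).1
    have h2 : p.1 ∈ U := by
      have h2 := (h (K.symm (p.1, (ρ.symm p.2).1))).2 h1
      rwa [K.apply_symm_apply] at h2
    have h3 := fst_target_inr (ρ := ρ) (K := K) (U := U) hB hBW (e := e) (p := extR ρ K.symm p) hp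
    exact ⟨⟨⟨h2, trivial⟩, hp, ⟨h3, trivial⟩, trivial⟩, fun h4 => Set.disjoint_left.1 hd h4 h2,
      fun h4 => Set.disjoint_left.1 hd h4 (fst_target_inl_true (B := B) h h3)⟩
  · rintro ⟨⟨-, hp, -⟩, -⟩
    exact hp

/-- Outside `W` only the edge `false` can start. It lands in the cut, where an edge of `B` must
follow and leaves the path there; the edge `true` has to leave it, and a fourth edge is impossible.
-/
theorem eq_conjPath (h : ∀ p, (K p).1 ∈ U ↔ p.1 ∈ W) (hd : Disjoint W U)
    (hB : B.IsGraphing ρ) (hBW : B.support = W) (p : X × I) :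
    ∀ l : List (Bool ⊕ B.Edge), l ≠ [] → l.IsChain Alternates →
      p ∈ (join ρ (transposition Ω K W U) B).pathSource l → p.1 ∉ W →
      ((join ρ (transposition Ω K W U) B).pathRealiser l p).1 ∉ W →
      ∃ e : B.Edge, l = [Sum.inl false, Sum.inr e, Sum.inl true]
  | [], hne, _, _, _, _ => absurd rfl hne
  | Sum.inr e :: l, _, _, hp, h1, _ => absurd (fst_mem_of_mem_inr hB hBW hp.1) h1
  | Sum.inl true :: l, _, _, hp, h1, _ => absurd (fst_mem_of_mem_inl_true hp.1) h1
  | [Sum.inl false], _, _, hp, _, h2 =>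
    absurd (fst_target_inl_false h (fst_mem_of_mem_inl_false hp.1)) h2
  | Sum.inl false :: Sum.inl _ :: l, _, hc, _, _, _ => by simp [Alternates] at hc
  | [Sum.inl false, Sum.inr e], _, _, hp, _, h2 => absurd (fst_target_inr hB hBW hp.2.1) h2
  | Sum.inl false :: Sum.inr _ :: Sum.inr _ :: l, _, hc, _, _, _ => by simp [Alternates] at hc
  | Sum.inl false :: Sum.inr _ :: Sum.inl false :: l, _, _, hp, _, _ =>
    absurd (fst_mem_of_mem_inl_false hp.2.2.1)
      (Set.disjoint_left.1 hd (fst_target_inr hB hBW hp.2.1))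
  | [Sum.inl false, Sum.inr e, Sum.inl true], _, _, _, _, _ => ⟨e, rfl⟩
  | Sum.inl false :: Sum.inr _ :: Sum.inl true :: _ :: l, _, hc, hp, _, _ =>
    absurd hp (notMem_pathSource_of_length h hd hB hBW p _ hc (by simp))

/-- Execution with the transposition along `K` moves a graphing along `K`. -/
theorem along_equivalent_exec (h : ∀ p, (K p).1 ∈ U ↔ p.1 ∈ W) (hd : Disjoint W U)
    (hB : B.IsGraphing ρ) (hBW : B.support = W) :
    (along ρ K B).Equivalent ((transposition Ω K W U).exec ρ B) := by
  have hsrc := along_source_eq (ρ := ρ) h hd hB hBW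
  -- An edge of an execution must be a path of non-null maximal domain, so `conjPath e` is available
  -- only for edges of non-negligible source.
  have hpos : ∀ e : {e : B.Edge // mu ((along ρ K B).source e) ≠ 0},
      IsAltPath ρ (transposition Ω K W U) B (conjPath e.1) := fun e => by
    refine ⟨List.cons_ne_nil _ _, by simp [conjPath, Alternates]; exact ⟨rfl, rfl⟩, fun h0 => e.2 ?_⟩
    rw [hsrc]
    exact measure_mono_null inter_subset_left h0
  let g : {e : (along ρ K B).Edge // mu ((along ρ K B).source e) ≠ 0} →
      {e : ((transposition Ω K W U).exec ρ B).Edge //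
        mu (((transposition Ω K W U).exec ρ B).source e) ≠ 0} :=
    fun e => ⟨⟨conjPath e.1, hpos e⟩, fun h0 =>
      e.2 ((congrArg mu (hsrc e.1)).trans h0)⟩
  have hg : Function.Bijective g := by
    constructor
    · intro e e' hee
      have := congrArg (fun x => x.1.1) hee
      simp only [g, conjPath, List.cons.injEq] at this
      exact Subtype.ext (Sum.inr.inj this.2.1)
    · rintro ⟨⟨l, hl⟩, hl0⟩
      -- A single point of the source suffices to determine the shape of the path.
      obtain ⟨p, hp, hp1, hp2⟩ := nonempty_of_measure_ne_zero hl0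
      rw [cut_eq hBW] at hp1 hp2
      obtain ⟨e, rfl⟩ := eq_conjPath h hd hB hBW p l hl.1 hl.2.1 hp hp1 hp2
      refine ⟨⟨e, ?_⟩, rfl⟩
      exact fun h0 => hl0 ((congrArg mu (hsrc e)).symm.trans h0)
  refine ⟨?_, Equiv.ofBijective g hg, fun e => ⟨(hsrc e.1).symm, rfl, ?_⟩⟩
  · rw [along_support (U := U) (hBW ▸ h)]
    change U = symmDiff (W ∪ U) B.support
    rw [hBW, symmDiff_eq_sup_sdiff_inf]
    ext x
    have : x ∈ W → x ∉ U := fun hx => Set.disjoint_left.1 hd hx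
    simp only [sup_eq_union, inf_eq_inter, Set.mem_sdiff, mem_union, mem_inter_iff]
    tauto
  · change 1 * (1 : Ω) * B.weight e.1 * 1 = B.weight e.1
    simp

end Transposition

end Graphing
end IG

namespace IG

variable {Ω : Type*} {ρ : (I × I) ≃ᵐ I}

/-! ## Delocations and `push` as measurable equivalences -/

/-- The action of a measurable bijection of `X` on `X × [0,1]`. -/
def locEquiv (θ : X ≃ᵐ X) : (X × I) ≃ᵐ (X × I) := θ.prodCongr (MeasurableEquiv.refl I)

theorem measurePreserving_locEquiv {θ : X ≃ᵐ X} (hθ : MeasurePreserving θ muX muX) :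
    MeasurePreserving (locEquiv θ) mu mu :=
  hθ.prod (MeasurePreserving.id _)

theorem fst_locEquiv_mem {θ : X ≃ᵐ X} {S : Set X} (p : X × I) :
    (locEquiv θ p).1 ∈ θ '' S ↔ p.1 ∈ S :=
  θ.injective.mem_set_image

/-- `push` as a measurable equivalence. -/
def pushEquiv (hρ : MeasurePreserving ρ) : (X × I) ≃ᵐ (X × I) where
  toEquiv := push ρ
  measurable_toFun := (measurePreserving_push hρ).measurable
  measurable_invFun := ((Mic.symm mic_push).quasiMeasurePreserving hρ).measurable

/-- The bijection underlying digging: `push` followed by the delocation `θ`. -/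
def digEquiv (hρ : MeasurePreserving ρ) (θ : X ≃ᵐ X) : (X × I) ≃ᵐ (X × I) :=
  (pushEquiv hρ).trans (locEquiv θ)

theorem mic_digEquiv (hρ : MeasurePreserving ρ) {θ : X ≃ᵐ X} (hθ : Mic ρ (locEquiv θ)) :
    Mic ρ (digEquiv hρ θ) :=
  hθ.comp mic_push

theorem measurePreserving_digEquiv (hρ : MeasurePreserving ρ) {θ : X ≃ᵐ X}
    (hθ : MeasurePreserving θ muX muX) : MeasurePreserving (digEquiv hρ θ) mu mu :=
  (measurePreserving_locEquiv hθ).comp (measurePreserving_push hρ)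

theorem fst_digEquiv_mem (hρ : MeasurePreserving ρ) (θ : X ≃ᵐ X) (V : Set X) (p : X × I) :
    (digEquiv hρ θ p).1 ∈ θ '' bangSupport (bangSupport V) ↔ p.1 ∈ bangSupport V :=
  fst_locEquiv_mem (push ρ p)

theorem measurableSet_bangSupport {V : Set X} (hV : MeasurableSet V) :
    MeasurableSet (bangSupport V) := by
  have h : Measurable fun y : X => ((y.1, tail (tail y.2)) : X) :=
    measurable_fst.prodMk (measurable_tail.comp (measurable_tail.comp measurable_snd))
  exact h hV

namespace Graphing

/-- Graphings with the same edges and weights are equal if their other data agree. -/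
theorem mk_eq (G : Graphing Ω) {S : Set X} {s : G.Edge → Set (X × I)}
    {r : G.Edge → X × I → X × I} (hS : S = G.support) (hs : s = G.source)
    (hr : r = G.realiser) : (⟨S, G.Edge, s, r, G.weight⟩ : Graphing Ω) = G := by
  subst hS hs hr; rfl

theorem conj_conj_symm (θ : X ≃ᵐ X) (G : Graphing Ω) :
    (G.conj (locEquiv θ).toEquiv.symm).conj (locEquiv θ).toEquiv = G := by
  refine mk_eq G ?_ (funext fun e => Equiv.image_symm_image _ _) (funext fun e => funext fun p => ?_)
  · have h1 : (G.conj (locEquiv θ).toEquiv.symm).support = θ.symm '' G.support :=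
      fst_image_eq (B := (locEquiv θ.symm).toEquiv) fst_locEquiv_mem
    rw [h1]
    refine (fst_image_eq (B := (locEquiv θ).toEquiv) (U := θ '' (θ.symm '' G.support))
      fst_locEquiv_mem).trans ?_
    exact θ.toEquiv.image_symm_image _
  · simp [conj]

theorem conj_symm_conj (θ : X ≃ᵐ X) (G : Graphing Ω) :
    (G.conj (locEquiv θ).toEquiv).conj (locEquiv θ).toEquiv.symm = G :=
  conj_conj_symm θ.symm G

/-! ### Perennised graphings under `push` and delocation -/

theorem IsGraphing.bang {G : Graphing Ω} (hG : G.IsGraphing ρ) : G.bang.IsGraphing ρ where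
  measurableSet_support := measurableSet_bangSupport hG.measurableSet_support
  measurableSet_source e := by
    have h : Measurable fun p : X × I => (((p.1.1, tail (tail p.1.2)), p.1.2 0) : X × I) := by
      have := measurable_tail
      fun_prop
    exact h (hG.measurableSet_source e)
  source_subset e _ hp := ⟨(hG.source_subset e hp).1, trivial⟩
  realiser_mem e := Mic.bangMap (hG.realiser_mem e)
  target_subset e := by
    rintro _ ⟨p, hp, rfl⟩
    exact ⟨(hG.target_subset e ⟨_, hp, rfl⟩).1, trivial⟩

/-- `φ` acts on the base point, the tail and the state `x`. `push` merely moves `x` to coordinate 2,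
where the double perennisation looks for it; everything else it moves is a parameter that `φ` never
sees. -/
theorem push_bangMap (φ : X × I → X × I) :
    push ρ ∘ bangMap φ ∘ (push ρ).symm = bangMap (bangMap φ) := by
  funext p
  refine Prod.ext (Prod.ext rfl (funext fun n => ?_)) ?_
  · rcases n with _ | _ | _ | _ | n <;> simp [bangMap, push, cons, tail_cons] <;> simp [tail]
  · simp [bangMap, push, cons]

/-- A perennised realiser fixes the dialect, so pairing that dialect with another changes nothing.
This is what removes the extra dialect created by execution. -/
theorem extL_bangMap (φ : X × I → X × I) : extL ρ (bangMap φ) = bangMap φ :=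
  funext fun p => Prod.ext rfl (ρ.apply_symm_apply p.2)

theorem extR_bangMap (φ : X × I → X × I) : extR ρ (bangMap φ) = bangMap φ :=
  funext fun p => Prod.ext rfl (ρ.apply_symm_apply p.2)

theorem extR_locEquiv (θ : X ≃ᵐ X) : extR ρ (locEquiv θ) = locEquiv θ :=
  funext fun p => Prod.ext rfl (ρ.apply_symm_apply p.2)

theorem bang_conj_push (G : Graphing Ω) : G.bang.conj (push ρ) = G.bang.bang := by
  refine mk_eq G.bang.bang ?_ (funext fun e => Set.ext fun p => ?_)
    (funext fun e => funext fun p => ?_)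
  · exact fst_image_eq fun p => Iff.rfl
  · exact mem_conj_source (B := push ρ) (G := G.bang)
  · exact congrFun (push_bangMap _) p

/-- In general `along` keeps the dialect of `K` apart from that of the graphing. Here the realisers
of `!A` use no dialect, so extending them on the left or on the right is the same, and all three
factors can be composed under a single `extR`. -/
theorem along_digEquiv_bang (hρ : MeasurePreserving ρ) (θ : X ≃ᵐ X) (G : Graphing Ω) :
    along ρ (digEquiv hρ θ) G.bang = (G.bang.conj (push ρ)).conj (locEquiv θ).toEquiv := by
  rw [bang_conj_push]
  refine mk_eq (G.bang.bang.conj (locEquiv θ).toEquiv) ?_ (funext fun e => Set.ext fun p => ?_)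
    (funext fun e => funext fun p => ?_)
  · exact (along_support (U := θ '' bangSupport (bangSupport G.support))
      (fst_digEquiv_mem hρ θ G.support)).trans
      (fst_image_eq (B := (locEquiv θ).toEquiv) fst_locEquiv_mem).symm
  · refine mem_along_source.trans (Iff.trans ?_
      (mem_conj_source (B := (locEquiv θ).toEquiv) (G := G.bang.bang)).symm)
    change (((θ.symm p.1).1, tail (tail (tail (tail (θ.symm p.1).2)))), (θ.symm p.1).2 2) ∈
      G.source e ↔ _
    rfl
  · change (extR ρ (digEquiv hρ θ) ∘ extL ρ (bangMap (G.realiser e)) ∘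
      extR ρ (digEquiv hρ θ).symm) p =
        (locEquiv θ ∘ bangMap (bangMap (G.realiser e)) ∘ locEquiv θ.symm) p
    rw [extL_bangMap, ← extR_bangMap, ← extR_comp, ← extR_comp]
    have : digEquiv hρ θ ∘ bangMap (G.realiser e) ∘ (digEquiv hρ θ).symm =
        locEquiv θ ∘ bangMap (bangMap (G.realiser e)) ∘ locEquiv θ.symm := by
      rw [← push_bangMap (ρ := ρ)]
      rfl
    rw [this, extR_comp, extR_comp, extR_bangMap, extR_locEquiv, extR_locEquiv, extR_bangMap]

section Meas

variable [Monoid Ω]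

/-- Moving the first graphing along a delocation amounts to moving the second one along the
inverse. -/
theorem meas_conj_locEquiv (hρ : MeasurePreserving ρ) (m : Ω → ℝ≥0∞) {θ : X ≃ᵐ X}
    (hθ : MeasurePreserving θ muX muX) {F G : Graphing Ω} (hF : F.IsGraphing ρ)
    (hG : (G.conj (locEquiv θ).toEquiv).IsGraphing ρ) :
    meas ρ m (F.conj (locEquiv θ).toEquiv.symm) G = meas ρ m F (G.conj (locEquiv θ).toEquiv) := by
  refine meas_transfer (F := F) (F' := F.conj (locEquiv θ).toEquiv.symm) (G' := G) m (locEquiv θ)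
    (measurePreserving_locEquiv hθ) id Function.injective_id (fun _ _ => Iff.rfl)
    (fun e he => absurd ⟨e, rfl⟩ he) (join_realiser_qmp hρ hF hG) ?_ ?_ ?_
  · rintro (e | e) p
    · exact (mem_conj_source (B := (locEquiv θ).toEquiv.symm) (G := F)
        (p := (p.1, (ρ.symm p.2).1))).symm
    · refine (mem_conj_source (B := (locEquiv θ).toEquiv) (G := G)).trans ?_
      change (θ.symm (θ p.1), (ρ.symm p.2).2) ∈ G.source e ↔ (p.1, (ρ.symm p.2).2) ∈ G.source e
      rw [θ.symm_apply_apply]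
  · rintro (e | e) p
    · refine Prod.ext ?_ rfl
      exact (θ.apply_symm_apply _).symm
    · change (θ (G.realiser e (θ.symm (θ p.1), _)).1, ρ (_, (G.realiser e (θ.symm (θ p.1), _)).2)) = _
      rw [θ.symm_apply_apply]
      rfl
  · rintro (e | e) <;> rfl

end Meas
end Graphing
end IG

namespace IG

variable {Ω : Type*} {ρ : (I × I) ≃ᵐ I}

/-! ## Projects -/

namespace Project

theorem IsProject.bang {a : Project Ω} (ha : a.IsProject ρ) : a.bang.IsProject ρ where
  measurableSet_support := measurableSet_bangSupport ha.measurableSet_support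
  wager_nonneg := ha.wager_nonneg
  support_slice i := congrArg bangSupport (ha.support_slice i)
  isGraphing_slice i := (ha.isGraphing_slice i).bang

theorem bang_conj_push {a : Project Ω} : a.bang.conj (push ρ) = a.bang.bang := by
  have hs : Prod.fst '' (push ρ '' (bangSupport a.support ×ˢ univ)) =
      bangSupport (bangSupport a.support) := Graphing.fst_image_eq fun p => Iff.rfl
  have hg : (fun i => (a.slice i).bang.conj (push ρ)) = fun i => (a.slice i).bang.bang :=
    funext fun i => Graphing.bang_conj_push _
  change Project.mk _ _ _ _ _ = Project.mk _ _ _ _ _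
  congr 1

theorem deloc_support (θ : X ≃ᵐ X) (a : Project Ω) : (a.deloc θ).support = θ '' a.support :=
  Graphing.fst_image_eq (B := (locEquiv θ).toEquiv) fst_locEquiv_mem

theorem deloc_deloc_symm (θ : X ≃ᵐ X) (a : Project Ω) : (a.deloc θ.symm).deloc θ = a := by
  have hs : ((a.deloc θ.symm).deloc θ).support = a.support := by
    rw [deloc_support, deloc_support]
    exact θ.toEquiv.image_symm_image _
  have hg : ((a.deloc θ.symm).deloc θ).slice = a.slice :=
    funext fun i => Graphing.conj_conj_symm θ (a.slice i)
  change Project.mk _ _ _ _ _ = Project.mk _ _ _ _ _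
  congr 1

theorem IsProject.deloc {a : Project Ω} (ha : a.IsProject ρ) {θ : X ≃ᵐ X}
    (hθ : Mic ρ (locEquiv θ)) : (a.deloc θ).IsProject ρ where
  measurableSet_support := by
    rw [deloc_support]
    exact θ.measurableSet_image.2 ha.measurableSet_support
  wager_nonneg := ha.wager_nonneg
  support_slice i := by
    change Prod.fst '' _ = Prod.fst '' _
    rw [ha.support_slice i]
  isGraphing_slice i := (ha.isGraphing_slice i).conj (locEquiv θ) hθ
    (U := θ '' (a.slice i).support)
    (θ.measurableSet_image.2 (ha.isGraphing_slice i).measurableSet_support) fst_locEquiv_mem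

variable [Monoid Ω]

theorem pairing_comm (hρ : MeasurePreserving ρ) (m : Ω → ℝ≥0∞) {a b : Project Ω}
    (ha : a.IsProject ρ) (hb : b.IsProject ρ) : pairing ρ m a b = pairing ρ m b a := by
  unfold pairing
  rw [add_comm (a.wager * _), Finset.sum_comm]
  congr 1
  refine Finset.sum_congr rfl fun j _ => Finset.sum_congr rfl fun i _ => ?_
  rw [mul_comm (a.coeff i), Graphing.meas_comm hρ m (ha.isGraphing_slice i) (hb.isGraphing_slice j)]

theorem Orthogonal.symm (hρ : MeasurePreserving ρ) {m : Ω → ℝ≥0∞} {a b : Project Ω}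
    (ha : a.IsProject ρ) (hb : b.IsProject ρ) (h : a.Orthogonal ρ m b) : b.Orthogonal ρ m a := by
  rw [Orthogonal, pairing_comm hρ m hb ha]
  exact ⟨h.1.symm, h.2⟩

end Project

/-! ## Digging -/

/-- The project that tests a project at the initial location as `t` tests the result of digging. -/
def undig (hρ : MeasurePreserving ρ) (θ : X ≃ᵐ X) (t : Project Ω) (W : Set X) : Project Ω where
  support := W
  wager := t.wager
  Index := t.Index
  coeff := t.coeff
  -- The test is first moved by `θ` to where the result of digging lives, then pulled back through
  -- the wire to the initial location.
  slice i := Graphing.along ρ (digEquiv hρ θ).symm ((t.slice i).conj (locEquiv θ).toEquiv)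

theorem undig_isProject (hρ : MeasurePreserving ρ) {θ : X ≃ᵐ X} {V : Set X} (hθ : Mic ρ (locEquiv θ)) (hV : MeasurableSet V) {t : Project Ω}
    (ht : t.IsProject ρ) (htV : t.support = bangSupport (bangSupport V)) :
    (undig hρ θ t (bangSupport V)).IsProject ρ := by
  have hsup : ∀ (i : t.Index) (p : X × I), ((digEquiv hρ θ).symm p).1 ∈ bangSupport V ↔
      p.1 ∈ ((t.slice i).conj (locEquiv θ).toEquiv).support := fun i p => by
    rw [← fst_digEquiv_mem hρ θ V, (digEquiv hρ θ).apply_symm_apply, ← htV, ← ht.support_slice i]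
    exact (Set.ext_iff.1 (Graphing.fst_image_eq (B := (locEquiv θ).toEquiv)
      fst_locEquiv_mem) p.1).symm
  exact
    { measurableSet_support := measurableSet_bangSupport hV
      wager_nonneg := ht.wager_nonneg
      support_slice := fun i => Graphing.along_support (hsup i)
      isGraphing_slice := fun i => ((ht.deloc hθ).isGraphing_slice i).along
        (Mic.symm (B := (digEquiv hρ θ).toEquiv) (mic_digEquiv hρ hθ))
        (measurableSet_bangSupport hV) (hsup i) }

section Dig

variable [Monoid Ω]

/-- The project whose only slice is the transposition along `K`. -/
noncomputable def transpositionProject (Ω : Type*) [Monoid Ω] (K : (X × I) ≃ᵐ (X × I)) (W U : Set X) :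
    Project Ω where
  support := W ∪ U
  wager := 0
  Index := Unit
  coeff _ := 1
  slice _ := Graphing.transposition Ω K W U

variable {K : (X × I) ≃ᵐ (X × I)} {W U : Set X}

theorem transpositionProject_isWinning (h : ∀ p, (K p).1 ∈ U ↔ p.1 ∈ W) (hd : Disjoint W U) :
    (transpositionProject Ω K W U).IsWinning :=
  ⟨⟨rfl, (), fun _ => rfl, rfl⟩, fun _ => Graphing.transposition_isUnionOfTranspositions h hd⟩

theorem transpositionProject_isProject (hK : Mic ρ K) (hW : MeasurableSet W)
    (hU : MeasurableSet U) (h : ∀ p, (K p).1 ∈ U ↔ p.1 ∈ W) :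
    (transpositionProject Ω K W U).IsProject ρ where
  measurableSet_support := hW.union hU
  wager_nonneg := le_rfl
  support_slice _ := rfl
  isGraphing_slice _ := Graphing.transposition_isGraphing hK hW hU h

/-- The wire has wager 0, total coefficient 1 and measurement 0 against `b`, so execution with it
leaves the wager unchanged. -/
theorem pairing_transpositionProject (m : Ω → ℝ≥0∞) (h : ∀ p, (K p).1 ∈ U ↔ p.1 ∈ W)
    (hd : Disjoint W U) {b : Project Ω} (hb : b.IsProject ρ) (hbW : b.support = W) :
    Project.pairing ρ m (transpositionProject Ω K W U) b = b.wager := by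
  have hm : ∀ i j, Graphing.meas ρ m ((transpositionProject Ω K W U).slice i) (b.slice j) = 0 :=
    fun i j => Graphing.meas_transposition m h hd (hb.isGraphing_slice j)
      ((hb.support_slice j).trans hbW)
  have hu : (transpositionProject Ω K W U).unit = 1 := by
    change ∑ _ : Unit, (1 : ℝ) = 1
    simp
  simp only [Project.pairing, hm, hu]
  simp [transpositionProject]

theorem exec_transpositionProject_isProject (hρ : MeasurePreserving ρ) (m : Ω → ℝ≥0∞)
    (hK : Mic ρ K) (hU : MeasurableSet U) (h : ∀ p, (K p).1 ∈ U ↔ p.1 ∈ W)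
    (hd : Disjoint W U) {b : Project Ω} (hb : b.IsProject ρ) (hbW : b.support = W) :
    ((transpositionProject Ω K W U).exec ρ m b).IsProject ρ where
  measurableSet_support :=
    ((hbW ▸ hb.measurableSet_support : MeasurableSet W).union hU).symmDiff hb.measurableSet_support
  wager_nonneg := hb.wager_nonneg.trans_eq (pairing_transpositionProject m h hd hb hbW).symm
  support_slice ij := congrArg (symmDiff (W ∪ U)) (hb.support_slice ij.2)
  isGraphing_slice ij := (Graphing.transposition_isGraphing hK
    (hbW ▸ hb.measurableSet_support) hU h).exec hρ (hb.isGraphing_slice ij.2)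

theorem exec_transpositionProject_support (m : Ω → ℝ≥0∞) (hd : Disjoint W U) {b : Project Ω}
    (hbW : b.support = W) : ((transpositionProject Ω K W U).exec ρ m b).support = U := by
  change symmDiff (W ∪ U) b.support = U
  rw [hbW, symmDiff_eq_sup_sdiff_inf]
  ext x
  have : x ∈ W → x ∉ U := fun hx => Set.disjoint_left.1 hd hx
  simp only [sup_eq_union, inf_eq_inter, Set.mem_sdiff, mem_union, mem_inter_iff]
  tauto

variable (hρ : MeasurePreserving ρ) (m : Ω → ℝ≥0∞) {θ : X ≃ᵐ X} {V : Set X}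

/-- Slice by slice, the delocation is transferred to the test, the execution is replaced by `along`,
and the motion along `K` is transferred to the test by `meas_along`. Wagers and total coefficients
are untouched by the wire. -/
theorem pairing_deloc_exec (hθ : MeasurePreserving θ muX muX) (hθ' : Mic ρ (locEquiv θ))
    (hV : MeasurableSet V)
    (hd : Disjoint (bangSupport V) (θ '' bangSupport (bangSupport V)))
    {b t : Project Ω} (hb : b.IsProject ρ) (hbV : b.support = bangSupport V)
    (ht : t.IsProject ρ) :
    Project.pairing ρ m (((transpositionProject Ω (digEquiv hρ θ) (bangSupport V)
      (θ '' bangSupport (bangSupport V))).exec ρ m b).deloc θ.symm) t =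
      Project.pairing ρ m b (undig hρ θ t (bangSupport V)) := by
  have h := fst_digEquiv_mem hρ θ V
  have hU : MeasurableSet (θ '' bangSupport (bangSupport V)) :=
    θ.measurableSet_image.2 (measurableSet_bangSupport (measurableSet_bangSupport hV))
  have hmeas : ∀ i j, Graphing.meas ρ m (((Graphing.transposition Ω (digEquiv hρ θ) (bangSupport V)
      (θ '' bangSupport (bangSupport V))).exec ρ (b.slice i)).conj (locEquiv θ).toEquiv.symm)
        (t.slice j) =
      Graphing.meas ρ m (b.slice i) (Graphing.along ρ (digEquiv hρ θ).symm
        ((t.slice j).conj (locEquiv θ).toEquiv)) := fun i j => by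
    have hB := hb.isGraphing_slice i
    have hBV := (hb.support_slice i).trans hbV
    have hT : ((t.slice j).conj (locEquiv θ).toEquiv).IsGraphing ρ := (ht.deloc hθ').isGraphing_slice j
    have hexec := (Graphing.transposition_isGraphing (mic_digEquiv hρ hθ')
      (measurableSet_bangSupport hV) hU h).exec hρ hB
    have halong := hB.along (mic_digEquiv hρ hθ') hU (hBV ▸ h)
    rw [Graphing.meas_conj_locEquiv hρ m hθ hexec hT,
      Graphing.meas_along hρ m (measurePreserving_digEquiv hρ hθ) halong hT]
    exact (Graphing.meas_congr hρ m halong hexec hT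
      (Graphing.along_equivalent_exec h hd hB hBV)).symm
  have hw := pairing_transpositionProject m h hd hb hbV
  have hunit : (((transpositionProject Ω (digEquiv hρ θ) (bangSupport V)
      (θ '' bangSupport (bangSupport V))).exec ρ m b).deloc θ.symm).unit = b.unit := by
    change ∑ ij : Unit × b.Index, (1 : ℝ) * b.coeff ij.2 = ∑ i, b.coeff i
    simp [Fintype.sum_prod_type]
  change Project.pairing ρ m (transpositionProject Ω _ _ _) b * (t.unit : EReal) +
    t.wager * _ + ∑ ij : Unit × b.Index, ∑ j : t.Index,
      (((1 : ℝ) * b.coeff ij.2 * t.coeff j : ℝ) : EReal) *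
        ((Graphing.meas ρ m (((Graphing.transposition Ω (digEquiv hρ θ) (bangSupport V)
      (θ '' bangSupport (bangSupport V))).exec ρ (b.slice ij.2)).conj (locEquiv θ).toEquiv.symm)
        (t.slice j) : ℝ≥0∞) : EReal) = _
  rw [hw, hunit]
  simp only [hmeas, one_mul, Fintype.sum_prod_type, Finset.univ_unique, Finset.sum_singleton]
  rfl

/-- The adjunction is applied again: moving `!a` along the wire gives `θ(!!a)`, and the remaining
`θ` cancels against the one on the test. -/
theorem pairing_undig_bang (hθ : MeasurePreserving θ muX muX) (hθ' : Mic ρ (locEquiv θ))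
    (hV : MeasurableSet V) {t a : Project Ω} (ht : t.IsProject ρ)
    (htV : t.support = bangSupport (bangSupport V)) (ha : a.IsProject ρ) :
    Project.pairing ρ m (undig hρ θ t (bangSupport V)) a.bang =
      Project.pairing ρ m t a.bang.bang := by
  rw [Project.pairing_comm hρ m (undig_isProject hρ hθ' hV ht htV) ha.bang,
    Project.pairing_comm hρ m ht ha.bang.bang]
  have hmeas : ∀ i j, Graphing.meas ρ m (a.slice i).bang (Graphing.along ρ (digEquiv hρ θ).symm
      ((t.slice j).conj (locEquiv θ).toEquiv)) =
      Graphing.meas ρ m (a.slice i).bang.bang (t.slice j) := fun i j => by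
    have hT : ((t.slice j).conj (locEquiv θ).toEquiv).IsGraphing ρ := (ht.deloc hθ').isGraphing_slice j
    have hA : ((a.slice i).bang.bang.conj (locEquiv θ).toEquiv).IsGraphing ρ := (ha.bang.bang.deloc hθ').isGraphing_slice i
    have heq := Graphing.along_digEquiv_bang hρ θ (a.slice i)
    rw [Graphing.bang_conj_push] at heq
    rw [Graphing.meas_along hρ m (measurePreserving_digEquiv hρ hθ) (heq ▸ hA) hT, heq,
      ← Graphing.meas_conj_locEquiv hρ m hθ hA hT, Graphing.conj_symm_conj]
  change _ + ∑ i : a.Index, ∑ j : t.Index, (_ : EReal) * ((Graphing.meas ρ m (a.slice i).bang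
    (Graphing.along ρ (digEquiv hρ θ).symm ((t.slice j).conj (locEquiv θ).toEquiv)) : ℝ≥0∞) :
      EReal) = _
  simp only [hmeas]
  rfl

end Dig

/-- A set lies in its bi-orthogonal; the symmetry of the measurement is needed because `orth` fixes
the order of the two arguments. -/
theorem bang_mem_ofCourse [Monoid Ω] (hρ : MeasurePreserving ρ) (m : Ω → ℝ≥0∞) {V : Set X}
    {A : Set (Project Ω)} {a : Project Ω} (haA : a ∈ A) (ha : a.IsProject ρ)
    (haV : a.support = V) (hbal : a.IsBalanced) : a.bang ∈ ofCourse ρ m V A :=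
  ⟨ha.bang, congrArg bangSupport haV, fun _ hs =>
    (hs.2.2 a.bang ⟨a, haA, hbal, rfl⟩).symm hρ hs.1 ha.bang⟩

end IG

/-! ### The digging theorem -/

open IG
theorem mainTheorem3 {Ω : Type*} [Monoid Ω] (m : Ω → ℝ≥0∞)
    (ρ : (I × I) ≃ᵐ I) (hρ : MeasurePreserving ρ)
    (V : Set X) (A : Set (Project Ω)) (hA : IsConduct ρ m V A)
    (θ : X ≃ᵐ X) (hθ : IsDelocation ρ θ)
    (hdisj : Disjoint (bangSupport V) (θ '' bangSupport (bangSupport V))) :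
    ∃ dig : Project Ω,
      dig.IsWinning ∧
      dig ∈ lolly ρ m (bangSupport V) (θ '' bangSupport (bangSupport V))
        (ofCourse ρ m V A)
        (Project.deloc θ '' ofCourse ρ m (bangSupport V) (ofCourse ρ m V A)) ∧
      ∀ a : Project Ω, a.IsProject ρ → a.support = V → a.IsBalanced →
        (dig.exec ρ m a.bang).Equivalent ((a.bang.conj (push ρ)).deloc θ) ∧
        a.bang.conj (push ρ) = a.bang.bang := by
  obtain ⟨hθ, hθ'⟩ := hθ
  have hV := hA.1
  have hAproj : ∀ a ∈ A, a.IsProject ρ ∧ a.support = V := fun a ha => by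
    rw [hA.2] at ha
    exact ⟨ha.1, ha.2.1⟩
  have h := fst_digEquiv_mem hρ θ V
  have hU : MeasurableSet (θ '' bangSupport (bangSupport V)) :=
    θ.measurableSet_image.2 (measurableSet_bangSupport (measurableSet_bangSupport hV))
  have hK : Mic ρ (digEquiv hρ θ) := mic_digEquiv hρ hθ'
  refine ⟨transpositionProject Ω (digEquiv hρ θ) (bangSupport V)
      (θ '' bangSupport (bangSupport V)), transpositionProject_isWinning h hdisj,
    ⟨transpositionProject_isProject hK (measurableSet_bangSupport hV) hU h, rfl, fun b hb => ?_⟩,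
    fun a ha haV hbal => ⟨?_, Project.bang_conj_push⟩⟩
  -- The preimage under `θ` is the result of digging moved along `θ⁻¹`; it is tested against every
  -- `t` orthogonal to `♯(!A)`.
  · refine ⟨_, ⟨?_, ?_, fun t ht => ?_⟩, Project.deloc_deloc_symm θ _⟩
    · exact (exec_transpositionProject_isProject hρ m hK hU h hdisj hb.1 hb.2.1).deloc
        (Mic.symm (B := (locEquiv θ).toEquiv) hθ')
    · rw [Project.deloc_support, exec_transpositionProject_support m hdisj hb.2.1]
      exact θ.toEquiv.symm_image_image _
    · have hs : undig hρ θ t (bangSupport V) ∈ orth ρ m (bangSupport V) (sharp A) := by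
        refine ⟨undig_isProject hρ hθ' hV ht.1 ht.2.1, rfl, ?_⟩
        rintro _ ⟨a, haA, hbal, rfl⟩
        obtain ⟨ha, haV⟩ := hAproj a haA
        -- `!a` has the wager and coefficient of `a`, so it is a balanced element of `!A` and `!!a`
        -- is among the generators that `t` tests.
        have := ht.2.2 a.bang.bang ⟨a.bang, bang_mem_ofCourse hρ m haA ha haV hbal, hbal, rfl⟩
        rw [Project.Orthogonal, pairing_undig_bang hρ m hθ hθ' hV ht.1 ht.2.1 ha]
        exact ⟨(congrArg bangSupport haV).symm, this.2⟩
      have := hb.2.2 _ hs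
      rw [Project.Orthogonal, pairing_deloc_exec hρ m hθ hθ' hV hdisj hb.1 hb.2.1 ht.1]
      refine ⟨?_, this.2⟩
      rw [Project.deloc_support, exec_transpositionProject_support m hdisj hb.2.1, ht.2.1]
      exact θ.toEquiv.symm_image_image _
  · have haV' : a.bang.support = bangSupport V := congrArg bangSupport haV
    -- The slices of the execution are indexed by pairs whose first component is the unique slice of
    -- the wire.
    refine ⟨?_, pairing_transpositionProject m h hdisj ha.bang haV', Equiv.punitProd _,
      fun i => ⟨(one_mul _).symm, ?_⟩⟩
    · rw [exec_transpositionProject_support m hdisj haV', Project.bang_conj_push,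
        Project.deloc_support]
      exact congrArg (fun S => θ '' bangSupport (bangSupport S)) haV.symm
    · have := (Graphing.along_equivalent_exec (ρ := ρ) h hdisj (ha.bang.isGraphing_slice i.2)
        ((ha.bang.support_slice i.2).trans haV')).symm
      rwa [show a.bang.slice i.2 = (a.slice i.2).bang from rfl,
        Graphing.along_digEquiv_bang hρ θ (a.slice i.2)] at this
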